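/- **Conventions.** For a simplicial set $Z$, let $Z^{ND}_n$ be its set of non-degenerate $n$-simplices and let $C^{ND}_*(Z)$ be its normalized chain complex: $C^{ND}_n(Z)=\mathbb Z[Z^{ND}_n]$, with $d z=\sum_i(-1)^i\partial_i z$, where the degenerate faces are cancelled. The elements of $Z^{ND}_n$ are called the $n$-cells of $C^{ND}_*(Z)$. In a chain complex with distinguished bases of cells, a $(p-1)$-cell $\sigma$ is a face (resp. a regular face) of a $p$-cell $\tau$ if its coefficient in $d\tau$ is non-zero (resp. $\pm1$). A *discrete vector field* $V$ is a set of pairs $(\sigma,\tau)$ of cells, called vectors, such that $\sigma$ is a regular face of $\tau$ and every cell appears at most once in $V$. The first components are the *source* cells, the second components are the *target* cells, and the cells which do not appear in $V$ are the *critical* cells. A *$V$-path* of length $m$ starting from $\sigma_0$ is a sequence $(\sigma_k,\tau_k)_{0\le k<m}$ of vectors of $V$ such that, for $0<k<m$, $\sigma_k$ is a face of $\tau_{k-1}$ different from $\sigma_{k-1}$. $V$ is *admissible* if for every cell $\sigma$ the lengths of the $V$-paths starting from $\sigma$ are bounded. A *reduction* $\rho=(f,g,h):\widehat C_*\Rightarrow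 C_*$ consists of chain maps $f:\widehat C_*\to C_*$ and $g:C_*\to\widehat C_*$ and an operator $h:\widehat C_*\to\widehat C_{*+1}$ such that $fg=\mathrm{id}$, $gf+dh+hd=\mathrm{id}$, $fh=0$, $hg=0$, $hh=0$. For a discrete vector field $V$, decompose the chain groups and the differential $d=(d_{ij})$ according to (1) target, (2) source, (3) critical cells. The *W-reduction* induced by $V$, defined when every component $d_{21}$ is an isomorphism (as happens for $V$ admissible), is the reduction to the graded module generated by the critical cells (the critical complex) given by $$d'=d_{33}-d_{31}d_{21}^{-1}d_{23},\quad f=\begin{pmatrix}0&-d_{31}d_{21}^{-1}&1\end{pmatrix},\quad g=\begin{pmatrix}-d_{21}^{-1}d_{23}\\0\\1\end{pmatrix},\quad h=d_{21}^{-1}\text{ on the source cells, and }0\text{ on the other cells}.$$ An *s-path* of dimension $n$ in the lattice $[0..p]\times[0..q]$ is a strictly increasing sequence $\pi=((a_i,b_i))_{0\le i\le n}$ for the product order; it is *interior* if both projections $i\mapsto a_i$ and $i\mapsto b_i$ are surjective, and $\partial_k\pi$ is obtained by skipping the $k$-th point. For an interior s-path the steps are vertical ($(0,1)$), horizontal ($(1,0)$)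 or diagonal ($(1,1)$). Let $X$, $Y$ be simplicial sets, $\sigma\in X^{ND}_p$, $\tau\in Y^{ND}_q$. An s-path $\pi$ codes the $n$-simplex $\pi(\sigma,\tau)=(a^*\sigma,b^*\tau)$ of $X\times Y$. Every non-degenerate simplex $\rho$ of $X\times Y$ is $\pi(\sigma,\tau)$ for a unique triple $(\sigma,\tau,\pi)$ with $\sigma,\tau$ non-degenerate and $\pi$ interior: if $\rho=(\eta_{i_{s-1}}\cdots\eta_{i_0}\sigma,\eta_{j_{t-1}}\cdots\eta_{j_0}\tau)$ is the canonical writing of $\rho$, the indices $i_*$ (resp. $j_*$) of this degeneracy configuration are the indices of the vertical (resp. horizontal) steps of $\pi$. Run $\pi$ backward from $(p,q)$; an *event* is a diagonal step, or a point $(a_k,b_k)$ at which (in the forward direction) a vertical step is followed by a horizontal step. The s-path is a *source* if the first event met is a diagonal step, a *target* if it is such a bend, and *critical* if there is no event; the only critical interior s-path is then the last simplex $\lambda_{p,q}=((0,0),(1,0),\dots,(p,0),(p,1),\dots,(p,q))$. The *Eilenberg-Zilber vector field* $V_{X\times Y}$ is the set of the pairs $\big((\partial_k\pi)(\sigma,\tau),\,\pi(\sigma,\tau)\big)$,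 where $\sigma,\tau$ are non-degenerate simplices of $X$ and $Y$, $\pi$ is an interior target s-path, and $k$ is the index of the bend which is its first event. **Theorem 46504 (Eilenberg-Zilber Theorem).** Let $X$ and $Y$ be simplicial sets. Then $V_{X\times Y}$ is an admissible discrete vector field on $C^{ND}_*(X\times Y)$, and its source, target and critical cells are exactly the non-degenerate simplices of $X\times Y$ whose s-path is respectively source, target and critical. It induces a W-reduction $$EZ:\;C^{ND}_*(X\times Y)\Rightarrow C^{ND}_*(X)\otimes C^{ND}_*(Y),$$ where the critical complex is identified with the tensor product as follows: for $\sigma\in X^{ND}_p$ and $\tau\in Y^{ND}_q$ the critical cell $\lambda_{p,q}(\sigma,\tau)$ corresponds to the generator $\sigma\otimes\tau$, and this is an isomorphism of graded modules; the differential $d'$ of the critical complex is the standard one, $d(\sigma\otimes\tau)=d\sigma\otimes\tau+(-1)^p\sigma\otimes d\tau$. -/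

import Mathlib

open CategoryTheory Limits Simplicial MonoidalCategory TensorProduct

universe u

/-! ### Algebraic cellular complexes

The definitions are written over a commutative ring `k`; the theorem is about `k = ℤ`. -/

/-- An algebraic cellular complex: a chain complex of `k`-modules all of whose chain groups are
free with a distinguished `k`-basis, not assumed to be finite; the elements of the index set
`cell p` are the `p`-cells. All the complexes considered here live in degrees `p ≥ 0`. -/
structure AlgCellComplex (k : Type) [CommRing k] where
  /-- the underlying chain complex -/
  complex : ChainComplex (ModuleCat.{u} k) ℕ
  /-- the `p`-cells -/
  cell : ℕ → Type u
  /-- the distinguished basis of the group of `p`-chains -/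
  basis : ∀ p, Module.Basis (cell p) k (complex.X p)

namespace AlgCellComplex

variable {k : Type} [CommRing k] (C : AlgCellComplex.{u} k)

/-- The incidence number `ε(σ, τ)`: the coefficient of `σ` in `dτ`. -/
noncomputable def incidence {p : ℕ} (σ : C.cell p) (τ : C.cell (p + 1)) : k :=
  (C.basis p).repr ((C.complex.d (p + 1) p).hom (C.basis (p + 1) τ)) σ

/-- `σ` is a face of `τ`. -/
def IsFace {p : ℕ} (σ : C.cell p) (τ : C.cell (p + 1)) : Prop :=
  C.incidence σ τ ≠ 0

/-- `σ` is a regular face of `τ`. -/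
def IsRegularFace {p : ℕ} (σ : C.cell p) (τ : C.cell (p + 1)) : Prop :=
  C.incidence σ τ = 1 ∨ C.incidence σ τ = -1

/-! ### Discrete vector fields -/

/-- A collection of pairs `(σ, τ)` where `σ` is a `p`-cell and `τ` a `(p+1)`-cell:
`V p σ τ` means that `(σ, τ)` belongs to the collection. -/
abbrev PairField : Type u :=
  ∀ p : ℕ, C.cell p → C.cell (p + 1) → Prop

variable {C}

/-- The `p`-cells which are the first component of a pair of `V`. -/
def sources (V : C.PairField) (p : ℕ) : Set (C.cell p) :=
  {σ | ∃ τ, V p σ τ}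

/-- The `p`-cells which are the second component of a pair of `V`. -/
def targets (V : C.PairField) (p : ℕ) : Set (C.cell p) :=
  match p with
  | 0 => ∅
  | p + 1 => {τ | ∃ σ, V p σ τ}

/-- The critical `p`-cells: those which do not appear in `V`. -/
def criticals (V : C.PairField) (p : ℕ) : Set (C.cell p) :=
  (sources V p ∪ targets V p)ᶜ

/-- `V` is a discrete vector field: the first component of every vector is a regular face of the
second one, and every cell appears at most once in `V`. -/
structure IsDiscreteVectorField (V : C.PairField) : Prop where
  regular : ∀ (p : ℕ) (σ : C.cell p) (τ : C.cell (p + 1)), V p σ τ → C.IsRegularFace σ τ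
  target_unique : ∀ (p : ℕ) (σ : C.cell p) (τ τ' : C.cell (p + 1)),
    V p σ τ → V p σ τ' → τ = τ'
  source_unique : ∀ (p : ℕ) (σ σ' : C.cell p) (τ : C.cell (p + 1)),
    V p σ τ → V p σ' τ → σ = σ'
  disjoint : ∀ p : ℕ, Disjoint (sources V p) (targets V p)

/-- A `V`-path: a finite sequence of vectors `(σ_k, τ_k)` of `V` such that `σ_k` is a face of
`τ_{k-1}`, not necessarily regular, different from `σ_{k-1}`. -/
def IsVPath (V : C.PairField) {p : ℕ} (π : List (C.cell p × C.cell (p + 1))) : Prop :=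
  (∀ v ∈ π, V p v.1 v.2) ∧ π.IsChain (fun v w => C.IsFace w.1 v.2 ∧ w.1 ≠ v.1)

/-- `V` is admissible: the lengths of the `V`-paths which start from a given cell are bounded. -/
def IsAdmissible (V : C.PairField) : Prop :=
  ∀ p : ℕ, ∃ bd : C.cell p → ℕ,
    ∀ (v : C.cell p × C.cell (p + 1)) (π : List (C.cell p × C.cell (p + 1))),
      IsVPath V (v :: π) → (v :: π).length ≤ bd v.1

/-! ### Block decompositions -/

variable (C)

/-- The inclusion in the `p`-chains of the submodule generated by a set of `p`-cells. -/
noncomputable def incl {p : ℕ} (P : Set (C.cell p)) : (P →₀ k) →ₗ[k] C.complex.X p :=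
  Finsupp.linearCombination k (fun c : P => C.basis p c)

/-- The projection of the `p`-chains on the submodule generated by a set of `p`-cells. -/
noncomputable def proj {p : ℕ} (P : Set (C.cell p)) : C.complex.X p →ₗ[k] (P →₀ k) :=
  Finsupp.lsubtypeDomain P ∘ₗ (C.basis p).repr.toLinearMap

/-- The block of the differential which starts from the `(p+1)`-cells of `P` and arrives at the
`p`-cells of `Q`. -/
noncomputable def block {p : ℕ} (P : Set (C.cell (p + 1))) (Q : Set (C.cell p)) :
    (P →₀ k) →ₗ[k] (Q →₀ k) :=
  C.proj Q ∘ₗ (C.complex.d (p + 1) p).hom ∘ₗ C.incl P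

end AlgCellComplex

/-! ### Reductions -/

/-- A (homology) reduction of the chain complex `K` on the chain complex `L`: chain maps `f` and
`g` and a homotopy operator `h` of degree `+1` such that `fg = id`, `id = dh + hd + gf`, `fh = 0`,
`hg = 0` and `hh = 0`. -/
structure Reduction {k : Type} [CommRing k] (K L : ChainComplex (ModuleCat.{u} k) ℕ) where
  /-- the projection -/
  f : K ⟶ L
  /-- the injection -/
  g : L ⟶ K
  /-- the homotopy operator -/
  h : Homotopy (𝟙 K) (f ≫ g)
  g_comp_f : g ≫ f = 𝟙 L
  h_comp_f : ∀ i j : ℕ, h.hom i j ≫ f.f j = 0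
  g_comp_h : ∀ i j : ℕ, g.f i ≫ h.hom i j = 0
  h_comp_h : ∀ i j k : ℕ, h.hom i j ≫ h.hom j k = 0

/-- The identifications of the chain groups of a chain complex `L` with the free modules generated
by the critical cells of `V`. -/
abbrev CriticalIdentification {k : Type} [CommRing k] {C : AlgCellComplex.{u} k} (V : C.PairField)
    (L : ChainComplex (ModuleCat.{u} k) ℕ) : Type u :=
  ∀ p : ℕ, (AlgCellComplex.criticals V p →₀ k) ≃ₗ[k] L.X p

/-- The reduction `ρ : C ⇒ L` is the W-reduction produced by the vector field `V`, where the chain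
groups of `L` are identified by `φ` with the free modules generated by the critical cells.

With respect to the decomposition (target cells) ⊕ (source cells) ⊕ (critical cells) of the chain
groups, the component `d₂₁` of the differential, from targets to sources, is an isomorphism, with
inverse `inv`, and
`d' = d₃₃ - d₃₁ d₂₁⁻¹ d₂₃`, `f = [0, -d₃₁ d₂₁⁻¹, 1]`, `g = [-d₂₁⁻¹ d₂₃, 0, 1]`, `h = d₂₁⁻¹`
(from sources to targets, and null on the other cells). -/
def IsWReduction {k : Type} [CommRing k] (C : AlgCellComplex.{u} k) (V : C.PairField)
    {L : ChainComplex (ModuleCat.{u} k) ℕ}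
    (φ : CriticalIdentification V L)
    (ρ : Reduction C.complex L) : Prop :=
  let T := AlgCellComplex.targets V
  let S := AlgCellComplex.sources V
  let K := AlgCellComplex.criticals V
  ∃ inv : ∀ p : ℕ, (S p →₀ k) →ₗ[k] (T (p + 1) →₀ k),
    (∀ p, inv p ∘ₗ C.block (T (p + 1)) (S p) = LinearMap.id) ∧
    (∀ p, C.block (T (p + 1)) (S p) ∘ₗ inv p = LinearMap.id) ∧
    (∀ p, (L.d (p + 1) p).hom ∘ₗ (φ (p + 1)).toLinearMap =
      (φ p).toLinearMap ∘ₗ (C.block (K (p + 1)) (K p) -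
        C.block (T (p + 1)) (K p) ∘ₗ inv p ∘ₗ C.block (K (p + 1)) (S p))) ∧
    (∀ p, (ρ.f.f p).hom =
      (φ p).toLinearMap ∘ₗ
        (C.proj (K p) - C.block (T (p + 1)) (K p) ∘ₗ inv p ∘ₗ C.proj (S p))) ∧
    ((ρ.g.f 0).hom ∘ₗ (φ 0).toLinearMap = C.incl (K 0)) ∧
    (∀ p, (ρ.g.f (p + 1)).hom ∘ₗ (φ (p + 1)).toLinearMap =
      C.incl (K (p + 1)) - C.incl (T (p + 1)) ∘ₗ inv p ∘ₗ C.block (K (p + 1)) (S p)) ∧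
    (∀ p, (ρ.h.hom p (p + 1)).hom = C.incl (T (p + 1)) ∘ₗ inv p ∘ₗ C.proj (S p))

/-! ### The normalized chain complex of a simplicial set -/

namespace SSet

variable (k : Type) [CommRing k] (X : SSet.{u})

/-- The coefficients `k`, in the universe of the simplicial sets under consideration. -/
noncomputable abbrev coeff : ModuleCat.{u} k := ModuleCat.of k (ULift.{u} k)

/-- The generator of the normalized chain group attached to a simplex
(it is null if this simplex is degenerate). -/
noncomputable def normGen {n : ℕ} (x : X _⦋n⦌) : (X.normalizedChainComplex (coeff.{u} k)).X n :=
  (X.ιNormalizedChainComplex (R := coeff.{u} k) x).hom (ULift.up 1)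

variable {k} in
lemma coeff_hom_ext {M : ModuleCat.{u} k} {f g : coeff.{u} k ⟶ M}
    (h : f.hom (ULift.up 1) = g.hom (ULift.up 1)) : f = g := by
  have h' : f.hom ∘ₗ (ULift.moduleEquiv (R := k) (M := k)).symm.toLinearMap =
      g.hom ∘ₗ (ULift.moduleEquiv (R := k) (M := k)).symm.toLinearMap := LinearMap.ext_ring h
  exact ModuleCat.hom_ext (LinearMap.ext fun a => LinearMap.congr_fun h' a.down)

/-- The coordinates of a normalized chain with respect to the non-degenerate simplices. -/
noncomputable def normCoord (n : ℕ) :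
    (X.normalizedChainComplex (coeff.{u} k)).X n →ₗ[k] (X.nonDegenerate n →₀ k) :=
  Finsupp.mapRange.linearMap (ULift.moduleEquiv (R := k) (M := k)).toLinearMap ∘ₗ
    (Cofan.IsColimit.desc (X.isColimitCofanNormalizedChainComplex (coeff.{u} k) n)
      (A := ModuleCat.of k (X.nonDegenerate n →₀ ULift.{u} k))
      (fun x => ModuleCat.ofHom (Finsupp.lsingle x))).hom

lemma normCoord_normGen {n : ℕ} (x : X.nonDegenerate n) :
    X.normCoord k n (X.normGen k x.1) = Finsupp.single x 1 := by
  have h := Cofan.IsColimit.fac (X.isColimitCofanNormalizedChainComplex (coeff.{u} k) n)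
    (A := ModuleCat.of k (X.nonDegenerate n →₀ ULift.{u} k))
    (fun x => ModuleCat.ofHom (Finsupp.lsingle x)) x
  have h' := congrArg (fun f => Finsupp.mapRange.linearMap
    (ULift.moduleEquiv (R := k) (M := k)).toLinearMap (f.hom (ULift.up 1))) h
  refine h'.trans ?_
  simp

/-- The basis of the normalized `n`-chains made of the non-degenerate `n`-simplices. -/
noncomputable def normBasis (n : ℕ) :
    Module.Basis (X.nonDegenerate n) k ((X.normalizedChainComplex (coeff.{u} k)).X n) :=
  Module.Basis.ofRepr <| LinearEquiv.ofLinearMap (X.normCoord k n)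
    (Finsupp.linearCombination k (fun x : X.nonDegenerate n => X.normGen k x.1))
    (by
      refine Finsupp.lhom_ext' fun x => LinearMap.ext_ring ?_
      simpa using X.normCoord_normGen k x)
    (by
      have key : ModuleCat.ofHom (Finsupp.linearCombination k
          (fun x : X.nonDegenerate n => X.normGen k x.1) ∘ₗ X.normCoord k n) = 𝟙 _ := by
        refine X.normalizedChainComplex_hom_ext (fun x hx => coeff_hom_ext ?_)
        have h2 := congrArg (Finsupp.linearCombination k
          (fun x : X.nonDegenerate n => X.normGen k x.1)) (X.normCoord_normGen k ⟨x, hx⟩)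
        rw [Finsupp.linearCombination_single, one_smul] at h2
        exact h2
      exact congrArg ModuleCat.Hom.hom key)

lemma normBasis_apply {n : ℕ} (x : X.nonDegenerate n) :
    X.normBasis k n x = X.normGen k x.1 := by
  simp [normBasis]

/-- The normalized chain complex of `X`, with the non-degenerate simplices as cells: the boundary
of a simplex is the alternating sum of its faces, where the degenerate faces are cancelled. -/
noncomputable def normalizedACC : AlgCellComplex.{u} k where
  complex := X.normalizedChainComplex (coeff.{u} k)
  cell n := X.nonDegenerate n
  basis n := X.normBasis k n

end SSet

/-! ### The tensor product of two chain complexes -/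

/-- The tensor product over `k`, as a bifunctor. -/
noncomputable def tensorBifunctor (k : Type) [CommRing k] :
    ModuleCat.{u} k ⥤ ModuleCat.{u} k ⥤ ModuleCat.{u} k where
  obj M :=
    { obj N := ModuleCat.of k (M ⊗[k] N)
      map f := ModuleCat.ofHom (LinearMap.lTensor M f.hom)
      map_id N := ModuleCat.hom_ext (LinearMap.lTensor_id M N)
      map_comp f g := ModuleCat.hom_ext (LinearMap.lTensor_comp M g.hom f.hom) }
  map f :=
    { app N := ModuleCat.ofHom (LinearMap.rTensor N f.hom)
      naturality _ _ g := ModuleCat.hom_ext <|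
        (LinearMap.rTensor_comp_lTensor _ f.hom g.hom).trans
          (LinearMap.lTensor_comp_rTensor _ f.hom g.hom).symm }
  map_id M := NatTrans.ext <| funext fun N => ModuleCat.hom_ext (LinearMap.rTensor_id N M)
  map_comp f g := NatTrans.ext <| funext fun N =>
    ModuleCat.hom_ext (LinearMap.rTensor_comp N g.hom f.hom)

section

variable {k : Type} [CommRing k]

instance : (tensorBifunctor.{u} k).PreservesZeroMorphisms where
  map_zero _ _ := NatTrans.ext <| funext fun N => ModuleCat.hom_ext (LinearMap.rTensor_zero N)

instance (M : ModuleCat.{u} k) : ((tensorBifunctor k).obj M).PreservesZeroMorphisms where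
  map_zero _ _ := ModuleCat.hom_ext (LinearMap.lTensor_zero M)

/-- The tensor product of two chain complexes: in degree `n` it is the direct sum of the
`K_p ⊗ L_q` for `p + q = n`, and `d(x ⊗ y) = dx ⊗ y + (-1)^p x ⊗ dy` for `x` of degree `p`. -/
noncomputable abbrev tensorComplex (K L : ChainComplex (ModuleCat.{u} k) ℕ) :
    ChainComplex (ModuleCat.{u} k) ℕ :=
  HomologicalComplex.mapBifunctor K L (tensorBifunctor k) (ComplexShape.down ℕ)

/-- The element `x ⊗ y` of degree `p + q` of the tensor product of two chain complexes. -/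
noncomputable def tmulComplex (K L : ChainComplex (ModuleCat.{u} k) ℕ) {p q : ℕ}
    (x : K.X p) (y : L.X q) : (tensorComplex K L).X (p + q) :=
  (HomologicalComplex.ιMapBifunctor K L (tensorBifunctor k) (ComplexShape.down ℕ)
    p q (p + q) rfl).hom (x ⊗ₜ[k] y)

end

/-! ### S-paths -/

/-- An s-path of dimension `n` in the lattice `[0..p] × [0..q]`: a sequence of `n + 1` points which
is strictly increasing for the product order. It represents a non-degenerate `n`-simplex of the
prism `Δ^p × Δ^q`. -/
structure SPath (p q n : ℕ) where
  /-- the points of the s-path -/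
  pt : Fin (n + 1) → Fin (p + 1) × Fin (q + 1)
  strictMono : StrictMono pt

namespace SPath

variable {p q n : ℕ}

/-- An s-path is interior if both its projections are surjective, that is, if the simplex which it
represents is not contained in the boundary of the prism. -/
def Interior (π : SPath p q n) : Prop :=
  (Function.Surjective fun i => (π.pt i).1) ∧ (Function.Surjective fun i => (π.pt i).2)

/-- The first projection, as a morphism of the simplex category. -/
def fst (π : SPath p q n) : ⦋n⦌ ⟶ ⦋p⦌ :=
  SimplexCategory.mkHom ⟨fun i => (π.pt i).1, fun _ _ h => (π.strictMono.monotone h).1⟩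

/-- The second projection, as a morphism of the simplex category. -/
def snd (π : SPath p q n) : ⦋n⦌ ⟶ ⦋q⦌ :=
  SimplexCategory.mkHom ⟨fun i => (π.pt i).2, fun _ _ h => (π.strictMono.monotone h).2⟩

/-- The `k`-th face of an s-path: the `k`-th point is skipped. -/
def face (π : SPath p q (n + 1)) (k : Fin (n + 2)) : SPath p q n where
  pt i := π.pt (k.succAbove i)
  strictMono := π.strictMono.comp (Fin.strictMono_succAbove k)

/-- The elementary step number `i`, from the `i`-th point to the next one, is vertical. For an
interior s-path this means that the first projection, a surjective morphism of the simplex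
category, has the degeneracy index `i`. -/
def Vertical (π : SPath p q n) (i : Fin n) : Prop :=
  (π.pt i.castSucc).1 = (π.pt i.succ).1

/-- The elementary step number `i` is horizontal. For an interior s-path this means that the
second projection has the degeneracy index `i`. -/
def Horizontal (π : SPath p q n) (i : Fin n) : Prop :=
  (π.pt i.castSucc).2 = (π.pt i.succ).2

/-- The elementary step number `i` is diagonal: the index `i` is in neither of the two lists of
the degeneracy configuration. -/
def Diagonal (π : SPath p q n) (i : Fin n) : Prop :=
  ¬ π.Vertical i ∧ ¬ π.Horizontal i

/-- The point number `k` is a right-angle bend made of a vertical step followed by a horizontal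
step; this is a `+90°` bend when the s-path is run backward. -/
def Bend (π : SPath p q n) (k : Fin (n + 1)) : Prop :=
  ∃ i j : Fin n, i.succ = k ∧ j.castSucc = k ∧ π.Vertical i ∧ π.Horizontal j

/-- When the s-path is run backward from its last point, the first event is the diagonal step
number `i`; an event is a diagonal step or a bend as above. -/
def FirstEventDiagonal (π : SPath p q n) (i : Fin n) : Prop :=
  π.Diagonal i ∧ (∀ j : Fin n, i < j → ¬ π.Diagonal j) ∧
    (∀ k : Fin (n + 1), i.castSucc < k → ¬ π.Bend k)

/-- When the s-path is run backward from its last point, the first event is the bend at the point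
number `k`. -/
def FirstEventBend (π : SPath p q n) (k : Fin (n + 1)) : Prop :=
  π.Bend k ∧ (∀ j : Fin n, k ≤ j.castSucc → ¬ π.Diagonal j) ∧
    (∀ l : Fin (n + 1), k < l → ¬ π.Bend l)

/-- Source s-paths: the first event is a diagonal step. -/
def IsSource (π : SPath p q n) : Prop := ∃ i, π.FirstEventDiagonal i

/-- Target s-paths: the first event is a bend. -/
def IsTarget (π : SPath p q n) : Prop := ∃ k, π.FirstEventBend k

/-- Critical s-paths: there is no event. -/
def IsCritical (π : SPath p q n) : Prop := (∀ i, ¬ π.Diagonal i) ∧ (∀ k, ¬ π.Bend k)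

/-- The last simplex `((0,0), (1,0), …, (p,0), (p,1), …, (p,q))` of the prism `Δ^p × Δ^q`. -/
def last (p q : ℕ) : SPath p q (p + q) where
  pt i := (⟨min i p, by omega⟩, ⟨i - p, by omega⟩)
  strictMono i j h := by
    have h' : (i : ℕ) < j := h
    rw [Prod.lt_iff]
    simp only [Fin.lt_def, Fin.le_def]
    omega

/-- The simplex of `X × Y` which is coded by an s-path `π` in the prism `σ × τ`, where `σ` is a
`p`-simplex of `X` and `τ` a `q`-simplex of `Y`. For `π` interior and `σ`, `τ` non-degenerate, this
is the canonical writing `(η^* σ, θ^* τ)` of this simplex, where the degeneracies `η` and `θ` are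
the projections of `π`: the vertical (resp. horizontal) steps are the degeneracy indices of the
first (resp. second) component. -/
def simplex {X Y : SSet.{u}} (π : SPath p q n) (σ : X _⦋p⦌) (τ : Y _⦋q⦌) :
    (X ⊗ Y : SSet.{u}) _⦋n⦌ :=
  (X.map π.fst.op σ, Y.map π.snd.op τ)

end SPath

/-! ### The Eilenberg-Zilber vector field -/

/-- The (unique) interior s-path defined by the degeneracy configuration of the simplex `ρ` of
`X × Y`, written in the canonical form, has the property `P`. -/
def HasSPath {X Y : SSet.{u}} {n : ℕ} (ρ : (X ⊗ Y : SSet.{u}) _⦋n⦌)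
    (P : ∀ {p q : ℕ}, SPath p q n → Prop) : Prop :=
  ∃ (p q : ℕ) (σ : X.nonDegenerate p) (τ : Y.nonDegenerate q) (π : SPath p q n),
    π.Interior ∧ ρ = π.simplex σ.1 τ.1 ∧ P π

/-- The Eilenberg-Zilber vector field of `X × Y`: its vectors are the pairs `(ρ, ρ')` of
non-degenerate simplices of `X × Y` such that `ρ'` is coded, in a prism `σ × τ` with `σ` and `τ`
non-degenerate, by an interior target s-path, and `ρ` is coded in the same prism by the face of
this s-path which skips the bend that is its first event. -/
def ezVectorField (X Y : SSet.{u}) : (SSet.normalizedACC ℤ (X ⊗ Y)).PairField :=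
  fun n (ρ : (X ⊗ Y : SSet.{u}).nonDegenerate n)
      (ρ' : (X ⊗ Y : SSet.{u}).nonDegenerate (n + 1)) =>
    ∃ (p q : ℕ) (σ : X.nonDegenerate p) (τ : Y.nonDegenerate q) (π : SPath p q (n + 1))
      (k : Fin (n + 2)), π.Interior ∧ π.FirstEventBend k ∧
        ρ'.1 = π.simplex σ.1 τ.1 ∧ ρ.1 = (π.face k).simplex σ.1 τ.1

/-!
A rank which decreases strictly along the `V`-paths makes the component `d₂₁` triangular with
invertible diagonal entries, hence bijective. For the Eilenberg-Zilber vector field, the rank of a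
source cell is given first by the dimension `p + q` of the prism which it spans, then by the sum of
`a + (q - b)` over the points `(a, b)` of its s-path: moving from a source to its target replaces a
diagonal step by a vertical step followed by a horizontal one, and the other faces of the target
which are source cells of the same prism skip a point where `a + (q - b)` is larger than at the
bend.

Once `d₂₁` is bijective, a chain map which vanishes on the target cells and identifies the critical
cells with a basis is necessarily the projection of the W-reduction: on the source cells it is
determined by its vanishing on the boundaries of the target cells. The Alexander-Whitney map is such
a chain map. A vertical step followed later by a horizontal one makes each of its terms degenerate
in the first or in the second factor, and on `λ_{p,q}(σ, τ)` only the term `σ ⊗ τ` survives. Hence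
`d'` is the differential of the tensor product.
-/

lemma submodule_mem_of_forall_single_mem {R κ : Type*} [CommRing R] {N : Submodule R (κ →₀ R)}
    {u : κ →₀ R} (h : ∀ a ∈ u.support, Finsupp.single a 1 ∈ N) : u ∈ N := by
  rw [← u.sum_single]
  refine N.sum_mem fun a ha => ?_
  simpa only [Finsupp.smul_single_one] using N.smul_mem (u a) (h a ha)

/-- A linear map between free modules is triangular, with respect to a bijection `e` between the
bases and a rank function, if it sends the basis vector `i` to the sum of a unit multiple of `e i`
and of a combination of vectors `e j` of smaller rank. -/
structure IsTriangularMap {R ι κ α : Type*} [CommRing R] [LT α]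
    (A : (ι →₀ R) →ₗ[R] (κ →₀ R)) (e : ι ≃ κ) (rank : ι → α) : Prop where
  isUnit_diag (i : ι) : IsUnit (A (Finsupp.single i 1) (e i))
  rank_lt {i j : ι} : A (Finsupp.single i 1) (e j) ≠ 0 → j ≠ i → rank j < rank i

namespace IsTriangularMap

variable {R ι κ α : Type*} [CommRing R] [Preorder α] {A : (ι →₀ R) →ₗ[R] (κ →₀ R)}
  {e : ι ≃ κ} {rank : ι → α}

lemma injective (hA : IsTriangularMap A e rank) : Function.Injective A := by
  refine (injective_iff_map_eq_zero A).2 fun u hu => by_contra fun hne => ?_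
  obtain ⟨i, hi, hmax⟩ := u.support.exists_maximalFor rank (Finsupp.support_nonempty_iff.2 hne)
  have eval : A u (e i) = ∑ j ∈ u.support, u j * A (Finsupp.single j 1) (e i) := by
    conv_lhs => rw [← u.sum_single]
    simp only [Finsupp.sum, map_sum, Finsupp.finsetSum_apply]
    refine Finset.sum_congr rfl fun j _ => ?_
    rw [← smul_eq_mul, ← Finsupp.smul_apply, ← map_smul, Finsupp.smul_single_one]
  have off_diag (j) (hj : j ∈ u.support) (hji : j ≠ i) :
      u j * A (Finsupp.single j 1) (e i) = 0 := by
    by_contra h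
    have hlt := hA.rank_lt (right_ne_zero_of_mul h) hji.symm
    exact hlt.not_ge (hmax hj hlt.le)
  rw [Finset.sum_eq_single_of_mem i hi off_diag, hu, Finsupp.zero_apply, eq_comm,
    (hA.isUnit_diag i).mul_left_eq_zero] at eval
  exact Finsupp.mem_support_iff.1 hi eval

lemma single_mem_range [WellFoundedLT α] (hA : IsTriangularMap A e rank) (i : ι) :
    Finsupp.single (e i) 1 ∈ LinearMap.range A := by
  induction i using (InvImage.wf rank wellFounded_lt).induction with
  | _ i ih =>
    set D := A (Finsupp.single i 1) (e i) with hD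
    have lower : A (Finsupp.single i 1) - Finsupp.single (e i) D ∈ LinearMap.range A := by
      refine submodule_mem_of_forall_single_mem fun b hb => ?_
      obtain ⟨j, rfl⟩ := e.surjective b
      have hji : j ≠ i := by
        rintro rfl
        simp [hD] at hb
      refine ih j (hA.rank_lt ?_ hji)
      simpa [Finsupp.single_eq_of_ne (e.injective.ne hji)] using hb
    have diag : Finsupp.single (e i) D ∈ LinearMap.range A := by
      simpa only [sub_sub_cancel] using
        Submodule.sub_mem _ (LinearMap.mem_range_self A (.single i 1)) lower
    rwa [← Finsupp.smul_single_one, Submodule.smul_mem_iff_of_isUnit _ (hA.isUnit_diag i)] at diag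

lemma bijective [WellFoundedLT α] (hA : IsTriangularMap A e rank) : Function.Bijective A := by
  refine ⟨hA.injective, LinearMap.range_eq_top.1 (eq_top_iff.2 fun u _ => ?_)⟩
  refine submodule_mem_of_forall_single_mem fun a _ => ?_
  simpa only [Equiv.apply_symm_apply] using hA.single_mem_range (e.symm a)

end IsTriangularMap

namespace AlgCellComplex

variable {k : Type} [CommRing k] {C : AlgCellComplex.{u} k} {V : C.PairField}

/-- A rank function for a vector field: it decreases strictly along the `V`-paths. -/
def IsRank (V : C.PairField) (rank : ∀ p, C.cell p → ℕ) : Prop :=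
  ∀ ⦃p : ℕ⦄ ⦃σ σ' : C.cell p⦄ ⦃τ : C.cell (p + 1)⦄,
    V p σ τ → σ' ∈ sources V p → C.IsFace σ' τ → σ' ≠ σ → rank p σ' < rank p σ

lemma isVPath_cons_cons {p : ℕ} {v w : C.cell p × C.cell (p + 1)}
    {π : List (C.cell p × C.cell (p + 1))} :
    IsVPath V (v :: w :: π) ↔
      V p v.1 v.2 ∧ C.IsFace w.1 v.2 ∧ w.1 ≠ v.1 ∧ IsVPath V (w :: π) := by
  simp only [IsVPath, List.forall_mem_cons, List.isChain_cons_cons]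
  tauto

lemma IsRank.isAdmissible {rank : ∀ p, C.cell p → ℕ} (h : IsRank V rank) : IsAdmissible V := by
  refine fun p => ⟨fun σ => rank p σ + 1, fun v π => ?_⟩
  induction π generalizing v with
  | nil => simp
  | cons w π ih =>
    rw [isVPath_cons_cons]
    rintro ⟨hv, hface, hne, hw⟩
    have hlt := h hv ⟨_, hw.1 w (by simp)⟩ hface hne
    have hlen := ih w hw
    rw [List.length_cons]
    dsimp only at hlen ⊢
    omega

lemma IsAdmissible.exists_isRank (h : IsAdmissible V) : ∃ rank, IsRank V rank := by
  choose bd hbd using h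
  let lengths (p : ℕ) (σ : C.cell p) : Set ℕ :=
    {m | ∃ τ π, IsVPath V ((σ, τ) :: π) ∧ ((σ, τ) :: π).length = m}
  have bdd (p σ) : BddAbove (lengths p σ) := by
    refine ⟨bd p σ, ?_⟩
    rintro _ ⟨τ, π, hπ, rfl⟩
    exact hbd p _ _ hπ
  refine ⟨fun p σ => sSup (lengths p σ), fun p σ σ' τ hV ⟨τ', hV'⟩ hface hne => ?_⟩
  have single : 1 ∈ lengths p σ' := ⟨τ', [], by simpa [IsVPath] using hV', rfl⟩
  obtain ⟨τ'', π, hπ, hlen⟩ := Nat.sSup_mem ⟨1, single⟩ (bdd p σ')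
  change sSup _ < sSup _
  rw [Nat.lt_iff_add_one_le, ← hlen]
  exact le_csSup (bdd p σ) ⟨τ, _, isVPath_cons_cons.2 ⟨hV, hface, hne, hπ⟩, rfl⟩

namespace IsDiscreteVectorField

/-- The bijection from the target cells to the source cells of a discrete vector field. -/
noncomputable def targetsEquivSources (hV : IsDiscreteVectorField V) (p : ℕ) :
    targets V (p + 1) ≃ sources V p :=
  Equiv.ofBijective (fun t => ⟨t.2.choose, t.1, t.2.choose_spec⟩) <| by
    constructor
    · intro t t' h
      have h' : t.2.choose = t'.2.choose := congrArg Subtype.val h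
      exact Subtype.ext (hV.target_unique p _ _ _ t.2.choose_spec (h' ▸ t'.2.choose_spec))
    · rintro ⟨s, t, hst⟩
      exact ⟨⟨t, s, hst⟩, Subtype.ext (hV.source_unique p _ _ t
        (⟨s, hst⟩ : ∃ σ, V p σ t).choose_spec hst)⟩

lemma targetsEquivSources_spec (hV : IsDiscreteVectorField V) {p : ℕ} (t : targets V (p + 1)) :
    V p (hV.targetsEquivSources p t) t :=
  t.2.choose_spec

end IsDiscreteVectorField

lemma incl_single {p : ℕ} {P : Set (C.cell p)} (c : P) :
    C.incl P (Finsupp.single c 1) = C.basis p c := by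
  simp [incl]

lemma proj_apply {p : ℕ} (P : Set (C.cell p)) (x : C.complex.X p) (c : P) :
    C.proj P x c = (C.basis p).repr x c := rfl

lemma proj_basis_of_mem {p : ℕ} {P : Set (C.cell p)} {c : C.cell p} (hc : c ∈ P) :
    C.proj P (C.basis p c) = Finsupp.single ⟨c, hc⟩ 1 := by
  classical
  ext b
  simp [proj_apply, Finsupp.single_apply, Subtype.ext_iff]

lemma proj_basis_of_notMem {p : ℕ} {P : Set (C.cell p)} {c : C.cell p} (hc : c ∉ P) :
    C.proj P (C.basis p c) = 0 := by
  ext b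
  simp [proj_apply, Finsupp.single_eq_of_ne' fun h : c = b => hc (h ▸ b.2)]

lemma block_single_apply {p : ℕ} {P : Set (C.cell (p + 1))} {Q : Set (C.cell p)} (τ : P) (σ : Q) :
    C.block P Q (Finsupp.single τ 1) σ = C.incidence σ.1 τ.1 := by
  simp [block, incl_single, proj_apply, incidence]

lemma IsRegularFace.isUnit_incidence {p : ℕ} {σ : C.cell p} {τ : C.cell (p + 1)}
    (h : C.IsRegularFace σ τ) : IsUnit (C.incidence σ τ) := by
  rcases h with h | h <;> simp [h]

lemma IsRank.isTriangularMap_block {rank : ∀ p, C.cell p → ℕ} (h : IsRank V rank)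
    (hV : IsDiscreteVectorField V) (p : ℕ) :
    IsTriangularMap (C.block (targets V (p + 1)) (sources V p)) (hV.targetsEquivSources p)
      (fun t => rank p (hV.targetsEquivSources p t)) where
  isUnit_diag t := by
    rw [block_single_apply]
    exact (hV.regular p _ _ (hV.targetsEquivSources_spec t)).isUnit_incidence
  rank_lt {t t'} hne hne' := by
    rw [block_single_apply] at hne
    refine h (hV.targetsEquivSources_spec t) (Subtype.prop _) hne fun heq => hne' ?_
    exact (hV.targetsEquivSources p).injective (Subtype.ext heq)

lemma IsDiscreteVectorField.bijective_block (hV : IsDiscreteVectorField V) (h : IsAdmissible V)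
    (p : ℕ) : Function.Bijective (C.block (targets V (p + 1)) (sources V p)) :=
  let ⟨_, hrank⟩ := h.exists_isRank
  (hrank.isTriangularMap_block hV p).bijective

end AlgCellComplex

namespace AlgCellComplex

variable {k : Type} [CommRing k] {C : AlgCellComplex.{u} k} {V : C.PairField}

lemma proj_incl_self {p : ℕ} (P : Set (C.cell p)) (u : P →₀ k) : C.proj P (C.incl P u) = u := by
  suffices C.proj P ∘ₗ C.incl P = LinearMap.id from LinearMap.congr_fun this u
  refine Finsupp.lhom_ext' fun c => LinearMap.ext_ring ?_
  simp [incl_single, proj_basis_of_mem c.2]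

lemma proj_incl_of_disjoint {p : ℕ} {P Q : Set (C.cell p)} (h : Disjoint P Q) (u : P →₀ k) :
    C.proj Q (C.incl P u) = 0 := by
  suffices C.proj Q ∘ₗ C.incl P = 0 from LinearMap.congr_fun this u
  refine Finsupp.lhom_ext' fun c => LinearMap.ext_ring ?_
  simp [incl_single, proj_basis_of_notMem (Set.disjoint_left.1 h c.2)]

lemma disjoint_sources_criticals (V : C.PairField) (p : ℕ) :
    Disjoint (sources V p) (criticals V p) :=
  Set.disjoint_compl_right_iff_subset.2 Set.subset_union_left

lemma disjoint_targets_criticals (V : C.PairField) (p : ℕ) :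
    Disjoint (targets V p) (criticals V p) :=
  Set.disjoint_compl_right_iff_subset.2 Set.subset_union_right

lemma hom_d_apply {L : ChainComplex (ModuleCat.{u} k) ℕ} (f : C.complex ⟶ L) (p : ℕ)
    (x : C.complex.X (p + 1)) :
    (f.f p).hom ((C.complex.d (p + 1) p).hom x) = (L.d (p + 1) p).hom ((f.f (p + 1)).hom x) := by
  rw [← ModuleCat.comp_apply, ← ModuleCat.comp_apply, f.comm]

lemma mem_sup_of_proj_sources_eq_zero {p : ℕ} {x : C.complex.X p}
    (hx : C.proj (sources V p) x = 0) :
    x ∈ LinearMap.range (C.incl (targets V p)) ⊔ LinearMap.range (C.incl (criticals V p)) := by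
  rw [← (C.basis p).linearCombination_repr x, Finsupp.linearCombination_apply]
  refine Submodule.sum_mem _ fun c hc => Submodule.smul_mem _ _ ?_
  have hS : c ∉ sources V p := fun hS =>
    Finsupp.mem_support_iff.1 hc (DFunLike.congr_fun hx (⟨c, hS⟩ : sources V p))
  by_cases hT : c ∈ targets V p
  · exact Submodule.mem_sup_left ⟨Finsupp.single ⟨c, hT⟩ 1, incl_single _⟩
  · exact Submodule.mem_sup_right ⟨Finsupp.single ⟨c, fun h => h.elim hS hT⟩ 1, incl_single _⟩

/-- A projection `f` of a cellular complex on a chain complex which is null on the target cells of a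
vector field and is an identification `φ` on its critical cells, when the component `d₂₁` of the
differential is an isomorphism. The W-reduction is determined by these data. -/
structure CriticalProjection (V : C.PairField) (L : ChainComplex (ModuleCat.{u} k) ℕ) where
  disjoint : ∀ p, Disjoint (sources V p) (targets V p)
  d₂₁ : ∀ p : ℕ, (targets V (p + 1) →₀ k) ≃ₗ[k] (sources V p →₀ k)
  coe_d₂₁ : ∀ p, (d₂₁ p).toLinearMap = C.block (targets V (p + 1)) (sources V p)
  φ : CriticalIdentification V L
  f : C.complex ⟶ L
  f_incl_targets : ∀ p (u : targets V p →₀ k), (f.f p).hom (C.incl _ u) = 0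
  f_incl_criticals : ∀ p (u : criticals V p →₀ k), (f.f p).hom (C.incl _ u) = φ p u

namespace CriticalProjection

variable {L : ChainComplex (ModuleCat.{u} k) ℕ} (D : CriticalProjection V L)

lemma proj_sources_d_incl_targets (p : ℕ) (u : targets V (p + 1) →₀ k) :
    C.proj (sources V p) ((C.complex.d (p + 1) p).hom (C.incl _ u)) = D.d₂₁ p u :=
  (LinearMap.congr_fun (D.coe_d₂₁ p) u).symm

include D in
/-- Since `d₂₁` is invertible, the boundaries of the target cells can replace the source cells in
the basis of the chain group. -/
lemma linearMap_ext {p : ℕ} {M : Type*} [AddCommGroup M] [Module k M]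
    {f g : C.complex.X p →ₗ[k] M}
    (hT : ∀ u, f (C.incl (targets V p) u) = g (C.incl (targets V p) u))
    (hd : ∀ u, f ((C.complex.d (p + 1) p).hom (C.incl (targets V (p + 1)) u)) =
      g ((C.complex.d (p + 1) p).hom (C.incl (targets V (p + 1)) u)))
    (hK : ∀ u, f (C.incl (criticals V p) u) = g (C.incl (criticals V p) u)) : f = g := by
  refine LinearMap.ext fun x => ?_
  set b := (C.complex.d (p + 1) p).hom (C.incl _ ((D.d₂₁ p).symm (C.proj _ x))) with hb
  have proj_sub : C.proj (sources V p) (x - b) = 0 := by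
    rw [map_sub, hb, proj_sources_d_incl_targets, LinearEquiv.apply_symm_apply, sub_self]
  obtain ⟨_, ⟨t, rfl⟩, _, ⟨c, rfl⟩, hx⟩ :=
    Submodule.mem_sup.1 (mem_sup_of_proj_sources_eq_zero proj_sub)
  rw [← add_eq_of_eq_sub hx]
  simp only [map_add, hT, hK, hb, hd]

lemma f_hom_eq (p : ℕ) :
    (D.f.f p).hom = (D.φ p).toLinearMap ∘ₗ (C.proj (criticals V p) -
      C.block (targets V (p + 1)) (criticals V p) ∘ₗ (D.d₂₁ p).symm.toLinearMap ∘ₗ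
        C.proj (sources V p)) := by
  refine D.linearMap_ext (fun u => ?_) (fun u => ?_) (fun u => ?_)
  · simp [D.f_incl_targets, proj_incl_of_disjoint (D.disjoint p).symm,
      proj_incl_of_disjoint (disjoint_targets_criticals V p)]
  · simp [hom_d_apply, D.f_incl_targets, D.proj_sources_d_incl_targets, block]
  · simp [D.f_incl_criticals, proj_incl_self,
      proj_incl_of_disjoint (disjoint_sources_criticals V p).symm]

/-- The operator `d₂₁⁻¹`, from the source cells to the target cells, extended by zero. -/
noncomputable def homotopyOp (p : ℕ) : C.complex.X p →ₗ[k] C.complex.X (p + 1) :=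
  C.incl (targets V (p + 1)) ∘ₗ (D.d₂₁ p).symm.toLinearMap ∘ₗ C.proj (sources V p)

lemma homotopyOp_incl_targets (p : ℕ) (u : targets V p →₀ k) :
    D.homotopyOp p (C.incl _ u) = 0 := by
  simp [homotopyOp, proj_incl_of_disjoint (D.disjoint p).symm]

lemma homotopyOp_incl_criticals (p : ℕ) (u : criticals V p →₀ k) :
    D.homotopyOp p (C.incl _ u) = 0 := by
  simp [homotopyOp, proj_incl_of_disjoint (disjoint_sources_criticals V p).symm]

lemma homotopyOp_d_incl_targets (p : ℕ) (u : targets V (p + 1) →₀ k) :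
    D.homotopyOp p ((C.complex.d (p + 1) p).hom (C.incl _ u)) = C.incl _ u := by
  simp [homotopyOp, D.proj_sources_d_incl_targets]

lemma homotopyOp_homotopyOp (p : ℕ) (x : C.complex.X p) :
    D.homotopyOp (p + 1) (D.homotopyOp p x) = 0 :=
  D.homotopyOp_incl_targets _ _

lemma f_homotopyOp (p : ℕ) (x : C.complex.X p) :
    (D.f.f (p + 1)).hom (D.homotopyOp p x) = 0 :=
  D.f_incl_targets _ _

/-- The operators `homotopyOp`, as a family indexed by all the pairs of degrees. -/
noncomputable def homotopyHom (i j : ℕ) : C.complex.X i ⟶ C.complex.X j :=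
  if h : i + 1 = j then
    ModuleCat.ofHom (D.homotopyOp i) ≫ eqToHom (congrArg C.complex.X h) else 0

lemma homotopyHom_succ (i : ℕ) :
    D.homotopyHom i (i + 1) = ModuleCat.ofHom (D.homotopyOp i) := by
  simp [homotopyHom]

lemma homotopyHom_eq_zero {i j : ℕ} (h : i + 1 ≠ j) : D.homotopyHom i j = 0 := dif_neg h

/-- The chain map `id - dh - hd`, which is the composition `gf` of the W-reduction. -/
noncomputable def retraction : C.complex ⟶ C.complex :=
  𝟙 _ - Homotopy.nullHomotopicMap D.homotopyHom

lemma retraction_f_zero_apply (x : C.complex.X 0) :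
    (D.retraction.f 0).hom x = x - (C.complex.d 1 0).hom (D.homotopyOp 0 x) := by
  rw [retraction, HomologicalComplex.sub_f_apply,
    Homotopy.nullHomotopicMap_f_of_not_rel_left (k₁ := 1) rfl (by simp), homotopyHom_succ]
  rfl

lemma retraction_f_succ_apply (p : ℕ) (x : C.complex.X (p + 1)) :
    (D.retraction.f (p + 1)).hom x = x - (D.homotopyOp p ((C.complex.d (p + 1) p).hom x) +
      (C.complex.d (p + 2) (p + 1)).hom (D.homotopyOp (p + 1) x)) := by
  rw [retraction, HomologicalComplex.sub_f_apply,
    Homotopy.nullHomotopicMap_f (k₂ := p + 2) (k₀ := p) rfl rfl, homotopyHom_succ,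
    homotopyHom_succ]
  rfl

lemma retraction_incl_targets (p : ℕ) (u : targets V p →₀ k) :
    (D.retraction.f p).hom (C.incl _ u) = 0 := by
  cases p with
  | zero =>
    have : u = 0 := Finsupp.ext fun t => t.2.elim
    simp [this]
  | succ p =>
    simp [retraction_f_succ_apply, homotopyOp_incl_targets, homotopyOp_d_incl_targets]

lemma homotopyOp_retraction_incl_criticals (p : ℕ) (u : criticals V p →₀ k) :
    D.homotopyOp p ((D.retraction.f p).hom (C.incl _ u)) = 0 := by
  cases p with
  | zero => simp [retraction_f_zero_apply, homotopyOp_incl_criticals]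
  | succ p =>
    simp [retraction_f_succ_apply, homotopyOp_incl_criticals, homotopyOp_homotopyOp]

lemma f_retraction_incl_criticals (p : ℕ) (u : criticals V p →₀ k) :
    (D.f.f p).hom ((D.retraction.f p).hom (C.incl _ u)) = D.φ p u := by
  cases p with
  | zero => simp [retraction_f_zero_apply, homotopyOp_incl_criticals, D.f_incl_criticals]
  | succ p =>
    simp [retraction_f_succ_apply, homotopyOp_incl_criticals, D.f_incl_criticals, f_homotopyOp]

/-- The injection of the W-reduction, in degree `p`. -/
noncomputable def injOp (p : ℕ) : L.X p →ₗ[k] C.complex.X p :=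
  (D.retraction.f p).hom ∘ₗ C.incl _ ∘ₗ (D.φ p).symm.toLinearMap

lemma f_injOp (p : ℕ) (y : L.X p) : (D.f.f p).hom (D.injOp p y) = y := by
  simp [injOp, f_retraction_incl_criticals]

lemma injOp_comp_f (p : ℕ) : D.injOp p ∘ₗ (D.f.f p).hom = (D.retraction.f p).hom := by
  refine D.linearMap_ext (fun u => ?_) (fun u => ?_) (fun u => ?_)
  · simp [D.f_incl_targets, retraction_incl_targets]
  · simp [hom_d_apply, D.f_incl_targets, retraction_incl_targets]
  · simp [injOp, D.f_incl_criticals]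

/-- The injection of the W-reduction. -/
noncomputable def inj : L ⟶ C.complex where
  f p := ModuleCat.ofHom (D.injOp p)
  comm' := by
    rintro _ p rfl
    ext y
    obtain ⟨x, rfl⟩ : ∃ x, (D.f.f (p + 1)).hom x = y := ⟨_, D.f_injOp _ y⟩
    have h (q : ℕ) (z) : D.injOp q ((D.f.f q).hom z) = (D.retraction.f q).hom z :=
      LinearMap.congr_fun (D.injOp_comp_f q) z
    change (C.complex.d (p + 1) p).hom (D.injOp _ _) = D.injOp p ((L.d (p + 1) p).hom _)
    rw [← hom_d_apply, h, h, hom_d_apply]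

lemma f_comp_inj : D.f ≫ D.inj = D.retraction := by
  ext p x
  exact LinearMap.congr_fun (D.injOp_comp_f p) x

lemma homotopyOp_injOp (p : ℕ) (y : L.X p) : D.homotopyOp p (D.injOp p y) = 0 :=
  D.homotopyOp_retraction_incl_criticals p _

/-- The W-reduction determined by its projection. -/
noncomputable def wReduction : Reduction C.complex L where
  f := D.f
  g := D.inj
  h :=
    { hom := D.homotopyHom
      zero _ _ h := D.homotopyHom_eq_zero h
      comm p := by
        rw [f_comp_inj]
        exact (add_sub_cancel _ _).symm }
  g_comp_f := by
    ext p y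
    exact D.f_injOp p y
  h_comp_f i j := by
    dsimp only
    by_cases h : i + 1 = j
    · subst h
      ext x
      simpa [homotopyHom_succ] using D.f_homotopyOp i x
    · rw [D.homotopyHom_eq_zero h, zero_comp]
  g_comp_h i j := by
    dsimp only
    by_cases h : i + 1 = j
    · subst h
      ext y
      simpa [homotopyHom_succ, inj] using D.homotopyOp_injOp i y
    · rw [D.homotopyHom_eq_zero h, comp_zero]
  h_comp_h i j l := by
    dsimp only
    by_cases h : i + 1 = j ∧ j + 1 = l
    · obtain ⟨rfl, rfl⟩ := h
      ext x
      simpa [homotopyHom_succ] using D.homotopyOp_homotopyOp i x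
    · rcases not_and_or.1 h with h | h
      · rw [D.homotopyHom_eq_zero h, zero_comp]
      · rw [D.homotopyHom_eq_zero h, comp_zero]

lemma wReduction_g_comp_φ_zero :
    (D.wReduction.g.f 0).hom ∘ₗ (D.φ 0).toLinearMap = C.incl (criticals V 0) := by
  refine LinearMap.ext fun u => ?_
  change D.injOp 0 (D.φ 0 u) = _
  simp [injOp, retraction_f_zero_apply, homotopyOp_incl_criticals]

lemma wReduction_g_comp_φ_succ (p : ℕ) :
    (D.wReduction.g.f (p + 1)).hom ∘ₗ (D.φ (p + 1)).toLinearMap =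
      C.incl (criticals V (p + 1)) - C.incl (targets V (p + 1)) ∘ₗ
        (D.d₂₁ p).symm.toLinearMap ∘ₗ C.block (criticals V (p + 1)) (sources V p) := by
  refine LinearMap.ext fun u => ?_
  change D.injOp (p + 1) (D.φ (p + 1) u) = _
  simp only [injOp, LinearMap.comp_apply, LinearEquiv.coe_coe, LinearEquiv.symm_apply_apply,
    retraction_f_succ_apply, homotopyOp_incl_criticals, map_zero, add_zero]
  rfl

lemma d_comp_φ (p : ℕ) :
    (L.d (p + 1) p).hom ∘ₗ (D.φ (p + 1)).toLinearMap =
      (D.φ p).toLinearMap ∘ₗ (C.block (criticals V (p + 1)) (criticals V p) -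
        C.block (targets V (p + 1)) (criticals V p) ∘ₗ (D.d₂₁ p).symm.toLinearMap ∘ₗ
          C.block (criticals V (p + 1)) (sources V p)) := by
  refine LinearMap.ext fun u => ?_
  change (L.d (p + 1) p).hom (D.φ (p + 1) u) = _
  rw [← D.f_incl_criticals, ← hom_d_apply, D.f_hom_eq]
  rfl

lemma isWReduction_wReduction : IsWReduction C V D.φ D.wReduction := by
  refine ⟨fun p => (D.d₂₁ p).symm, fun p => ?_, fun p => ?_, D.d_comp_φ, D.f_hom_eq,
    D.wReduction_g_comp_φ_zero, D.wReduction_g_comp_φ_succ, fun p => ?_⟩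
  · rw [← D.coe_d₂₁]
    exact (D.d₂₁ p).symm_comp
  · rw [← D.coe_d₂₁]
    exact (D.d₂₁ p).comp_symm
  · exact congrArg ModuleCat.Hom.hom (D.homotopyHom_succ p)

end CriticalProjection

theorem IsDiscreteVectorField.exists_isWReduction (hV : IsDiscreteVectorField V)
    (hadm : IsAdmissible V) {L : ChainComplex (ModuleCat.{u} k) ℕ}
    (φ : CriticalIdentification V L) (f : C.complex ⟶ L)
    (f_targets : ∀ p, ∀ t ∈ targets V p, (f.f p).hom (C.basis p t) = 0)
    (f_criticals : ∀ p (c : criticals V p),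
      (f.f p).hom (C.basis p c) = φ p (Finsupp.single c 1)) :
    ∃ ρ : Reduction C.complex L, IsWReduction C V φ ρ := by
  let D : CriticalProjection V L :=
    { disjoint := hV.disjoint
      d₂₁ p := LinearEquiv.ofBijective _ (hV.bijective_block hadm p)
      coe_d₂₁ _ := rfl
      φ := φ
      f := f
      f_incl_targets p := LinearMap.congr_fun <|
        show (f.f p).hom ∘ₗ C.incl (targets V p) = 0 from
        Finsupp.lhom_ext' fun t => LinearMap.ext_ring <| by simpa [incl] using f_targets p t t.2
      f_incl_criticals p := LinearMap.congr_fun <|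
        show (f.f p).hom ∘ₗ C.incl (criticals V p) = (φ p).toLinearMap from
        Finsupp.lhom_ext' fun c => LinearMap.ext_ring <| by simpa [incl] using f_criticals p c }
  exact ⟨D.wReduction, D.isWReduction_wReduction⟩

end AlgCellComplex

/-- The values of a finite sequence `f`, extended to all the natural indices by the last value. -/
def natExtend {m n : ℕ} (f : Fin (n + 1) → Fin (m + 1)) (i : ℕ) : ℕ :=
  f (Fin.clamp i n)

section

variable {m n : ℕ} {f : Fin (n + 1) → Fin (m + 1)}

lemma natExtend_val (f : Fin (n + 1) → Fin (m + 1)) (i : Fin (n + 1)) : natExtend f i = f i := by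
  rw [natExtend, show Fin.clamp i n = i from Fin.ext (by simp [Nat.lt_succ_iff.1 i.2])]

lemma monotone_natExtend (hf : Monotone f) : Monotone (natExtend f) :=
  fun _ _ h => hf (Fin.clamp_monotone h)

lemma natExtend_le (f : Fin (n + 1) → Fin (m + 1)) (i : ℕ) : natExtend f i ≤ m :=
  Nat.lt_succ_iff.1 (Fin.is_lt _)

lemma natExtend_zero (hf : Monotone f) (hs : Function.Surjective f) : natExtend f 0 = 0 := by
  obtain ⟨j, hj⟩ := hs 0
  have h : f 0 ≤ f j := hf (Fin.zero_le j)
  rw [← Fin.val_zero (n + 1), natExtend_val]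
  simpa [hj] using h

lemma natExtend_last (hf : Monotone f) (hs : Function.Surjective f) : natExtend f n = m := by
  obtain ⟨j, hj⟩ := hs (Fin.last m)
  have h : Fin.last m ≤ f (Fin.last n) := hj ▸ hf (Fin.le_last j)
  have hlast := natExtend_val f (Fin.last n)
  rw [Fin.val_last] at hlast
  rw [hlast, Fin.last_le_iff.1 h, Fin.val_last]

lemma natExtend_succ_le (hf : Monotone f) (hs : Function.Surjective f) (i : ℕ) :
    natExtend f (i + 1) ≤ natExtend f i + 1 := by
  by_contra! h
  obtain ⟨j, hj⟩ := hs ⟨natExtend f i + 1, h.trans (Fin.is_lt _)⟩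
  have hj' : natExtend f j = natExtend f i + 1 := by rw [natExtend_val, hj]
  clear hj
  rcases le_or_gt (j : ℕ) i with hji | hij
  · have := monotone_natExtend hf hji
    omega
  · have : natExtend f (i + 1) ≤ natExtend f j := monotone_natExtend hf hij
    omega

lemma natExtend_comp_succAbove (f : Fin (n + 2) → Fin (m + 1)) (k : Fin (n + 2)) {i : ℕ}
    (hi : i ≤ n) :
    natExtend (f ∘ k.succAbove) i = natExtend f (if i < k then i else i + 1) := by
  have : k.succAbove (Fin.clamp i n) = Fin.clamp (if i < k then i else i + 1) (n + 1) := by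
    ext
    simp only [Fin.succAbove, Fin.lt_def, Fin.val_castSucc, Fin.coe_clamp]
    split_ifs <;> simp only [Fin.val_castSucc, Fin.val_succ, Fin.coe_clamp] <;> omega
  simp only [natExtend, Function.comp_apply, this]

lemma surjective_comp_succAbove {α : Type*} {f : Fin (n + 1) → α} (hf : Function.Surjective f)
    {j k : Fin (n + 1)} (hjk : j ≠ k) (h : f j = f k) : Function.Surjective (f ∘ k.succAbove) := by
  intro a
  obtain ⟨i, rfl⟩ := hf a
  obtain rfl | hik := eq_or_ne i k
  · obtain ⟨l, rfl⟩ := Fin.exists_succAbove_eq hjk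
    exact ⟨l, h⟩
  · obtain ⟨l, rfl⟩ := Fin.exists_succAbove_eq hik
    exact ⟨l, rfl⟩

end

namespace SPath

variable {p q n : ℕ}

/-! ### Coordinates and events of an s-path -/

/-- The first coordinates of the points of an s-path, indexed by the natural numbers: the last
point is repeated. -/
def x (π : SPath p q n) : ℕ → ℕ := natExtend fun j => (π.pt j).1

/-- The second coordinates of the points of an s-path, indexed by the natural numbers: the last
point is repeated. -/
def y (π : SPath p q n) : ℕ → ℕ := natExtend fun j => (π.pt j).2

lemma x_val (π : SPath p q n) (i : Fin (n + 1)) : π.x i = (π.pt i).1 := natExtend_val _ i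

lemma y_val (π : SPath p q n) (i : Fin (n + 1)) : π.y i = (π.pt i).2 := natExtend_val _ i

lemma x_mono (π : SPath p q n) : Monotone π.x :=
  monotone_natExtend fun _ _ h => (π.strictMono.monotone h).1

lemma y_mono (π : SPath p q n) : Monotone π.y :=
  monotone_natExtend fun _ _ h => (π.strictMono.monotone h).2

lemma x_le (π : SPath p q n) (i : ℕ) : π.x i ≤ p := natExtend_le _ i

lemma y_le (π : SPath p q n) (i : ℕ) : π.y i ≤ q := natExtend_le _ i

lemma pt_injective : Function.Injective (pt : SPath p q n → _) := by
  rintro ⟨f, hf⟩ ⟨g, hg⟩ rfl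
  rfl

lemma x_lt_or_y_lt (π : SPath p q n) {i : ℕ} (hi : i < n) :
    π.x i < π.x (i + 1) ∨ π.y i < π.y (i + 1) := by
  have h := π.strictMono (Fin.castSucc_lt_succ (i := ⟨i, hi⟩))
  rw [Prod.lt_iff, Fin.lt_def, Fin.lt_def, ← x_val, ← x_val, ← y_val, ← y_val] at h
  exact h.imp And.left And.right

lemma Interior.x_last {π : SPath p q n} (hπ : π.Interior) : π.x n = p :=
  natExtend_last (fun _ _ h => (π.strictMono.monotone h).1) hπ.1

lemma Interior.y_last {π : SPath p q n} (hπ : π.Interior) : π.y n = q :=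
  natExtend_last (fun _ _ h => (π.strictMono.monotone h).2) hπ.2

lemma Interior.x_zero {π : SPath p q n} (hπ : π.Interior) : π.x 0 = 0 :=
  natExtend_zero (fun _ _ h => (π.strictMono.monotone h).1) hπ.1

lemma Interior.y_zero {π : SPath p q n} (hπ : π.Interior) : π.y 0 = 0 :=
  natExtend_zero (fun _ _ h => (π.strictMono.monotone h).2) hπ.2

lemma Interior.x_succ_le {π : SPath p q n} (hπ : π.Interior) (i : ℕ) : π.x (i + 1) ≤ π.x i + 1 :=
  natExtend_succ_le (fun _ _ h => (π.strictMono.monotone h).1) hπ.1 i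

lemma Interior.y_succ_le {π : SPath p q n} (hπ : π.Interior) (i : ℕ) : π.y (i + 1) ≤ π.y i + 1 :=
  natExtend_succ_le (fun _ _ h => (π.strictMono.monotone h).2) hπ.2 i

lemma x_face (π : SPath p q (n + 1)) (k : Fin (n + 2)) {i : ℕ} (hi : i ≤ n) :
    (π.face k).x i = π.x (if i < k then i else i + 1) :=
  natExtend_comp_succAbove (fun j => (π.pt j).1) k hi

lemma y_face (π : SPath p q (n + 1)) (k : Fin (n + 2)) {i : ℕ} (hi : i ≤ n) :
    (π.face k).y i = π.y (if i < k then i else i + 1) :=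
  natExtend_comp_succAbove (fun j => (π.pt j).2) k hi

/-- The step number `i`, from the point number `i` to the next one, is diagonal. There is no such
step for `i ≥ n`, the last point being repeated. -/
def DiagonalAt (π : SPath p q n) (i : ℕ) : Prop :=
  π.x i ≠ π.x (i + 1) ∧ π.y i ≠ π.y (i + 1)

/-- The step number `i` is vertical and the next one is horizontal: there is a bend at the point
number `i + 1`. -/
def BendAt (π : SPath p q n) (i : ℕ) : Prop :=
  i + 1 < n ∧ π.x i = π.x (i + 1) ∧ π.y (i + 1) = π.y (i + 2)

/-- When the s-path is run backward, no event is met up to the point number `m`. -/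
def NoEventFrom (π : SPath p q n) (m : ℕ) : Prop :=
  ∀ i, m ≤ i → ¬ π.DiagonalAt i ∧ ¬ π.BendAt i

lemma DiagonalAt.lt {π : SPath p q n} {i : ℕ} (h : π.DiagonalAt i) : i < n := by
  by_contra! hi
  refine h.1 ?_
  simp only [x, natExtend, Fin.clamp]
  congr 3
  ext
  simp only
  omega

lemma DiagonalAt.not_bendAt {π : SPath p q n} {i : ℕ} (h : π.DiagonalAt i) : ¬ π.BendAt i :=
  fun h' => h.1 h'.2.1

lemma NoEventFrom.mono {π : SPath p q n} {m m' : ℕ} (h : π.NoEventFrom m) (hm : m ≤ m') :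
    π.NoEventFrom m' :=
  fun i hi => h i (hm.trans hi)

lemma vertical_iff (π : SPath p q n) (i : Fin n) : π.Vertical i ↔ π.x i = π.x (i + 1) := by
  rw [Vertical, Fin.ext_iff, ← x_val, ← x_val, Fin.val_castSucc, Fin.val_succ]

lemma horizontal_iff (π : SPath p q n) (i : Fin n) : π.Horizontal i ↔ π.y i = π.y (i + 1) := by
  rw [Horizontal, Fin.ext_iff, ← y_val, ← y_val, Fin.val_castSucc, Fin.val_succ]

lemma diagonal_iff (π : SPath p q n) (i : Fin n) : π.Diagonal i ↔ π.DiagonalAt i := by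
  rw [Diagonal, vertical_iff, horizontal_iff, DiagonalAt]

lemma bend_iff (π : SPath p q n) (k : Fin (n + 1)) :
    π.Bend k ↔ ∃ i, (k : ℕ) = i + 1 ∧ π.BendAt i := by
  constructor
  · rintro ⟨i, j, rfl, hj, hv, hh⟩
    have hj : (j : ℕ) = i + 1 := congrArg Fin.val hj
    rw [vertical_iff] at hv
    rw [horizontal_iff, hj] at hh
    exact ⟨i, rfl, hj ▸ j.2, hv, hh⟩
  · rintro ⟨i, hk, hi, hv, hh⟩
    exact ⟨⟨i, by omega⟩, ⟨i + 1, hi⟩, Fin.ext hk.symm, Fin.ext hk.symm,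
      (vertical_iff _ _).2 hv, (horizontal_iff _ _).2 hh⟩

lemma forall_not_diagonal_iff (π : SPath p q n) (m : ℕ) :
    (∀ j : Fin n, m ≤ j → ¬ π.Diagonal j) ↔ ∀ i, m ≤ i → ¬ π.DiagonalAt i :=
  ⟨fun h i hi hd => h ⟨i, hd.lt⟩ hi ((diagonal_iff _ _).2 hd),
    fun h j hj hd => h j hj ((diagonal_iff _ _).1 hd)⟩

lemma forall_not_bend_iff (π : SPath p q n) (m : ℕ) :
    (∀ l : Fin (n + 1), m < l → ¬ π.Bend l) ↔ ∀ i, m ≤ i → ¬ π.BendAt i := by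
  constructor
  · exact fun h i hi hb => h ⟨i + 1, by have := hb.1; omega⟩ (Nat.lt_succ_of_le hi)
      ((bend_iff _ _).2 ⟨i, rfl, hb⟩)
  · rintro h l hl hb
    obtain ⟨i, hli, hi⟩ := (bend_iff _ _).1 hb
    exact h i (by omega) hi

lemma noEventFrom_iff (π : SPath p q n) (m : ℕ) : π.NoEventFrom m ↔
    (∀ j : Fin n, m ≤ j → ¬ π.Diagonal j) ∧ ∀ l : Fin (n + 1), m < l → ¬ π.Bend l := by
  rw [forall_not_diagonal_iff, forall_not_bend_iff]
  exact ⟨fun h => ⟨fun i hi => (h i hi).1, fun i hi => (h i hi).2⟩,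
    fun h i hi => ⟨h.1 i hi, h.2 i hi⟩⟩

lemma firstEventBend_iff (π : SPath p q n) (k : Fin (n + 1)) :
    π.FirstEventBend k ↔ ∃ i, (k : ℕ) = i + 1 ∧ π.BendAt i ∧ π.NoEventFrom (i + 1) := by
  have h : π.FirstEventBend k ↔ π.Bend k ∧ π.NoEventFrom k :=
    and_congr_right' (noEventFrom_iff π k).symm
  rw [h, bend_iff]
  constructor
  · rintro ⟨⟨i, hk, hb⟩, hn⟩
    exact ⟨i, hk, hb, hk ▸ hn⟩
  · rintro ⟨i, hk, hb, hn⟩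
    exact ⟨⟨i, hk, hb⟩, hk ▸ hn⟩

lemma firstEventDiagonal_iff (π : SPath p q n) (i : Fin n) :
    π.FirstEventDiagonal i ↔ π.DiagonalAt i ∧ π.NoEventFrom (i + 1) := by
  have h : π.FirstEventDiagonal i ↔ π.Diagonal i ∧ (∀ j : Fin n, (i : ℕ) + 1 ≤ j → ¬ π.Diagonal j) ∧
      ∀ l : Fin (n + 1), (i : ℕ) < l → ¬ π.Bend l := Iff.rfl
  rw [h, diagonal_iff, forall_not_diagonal_iff, forall_not_bend_iff]
  refine and_congr_right fun hd => ⟨fun ⟨h₁, h₂⟩ j hj => ⟨h₁ j hj, h₂ j (by omega)⟩,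
    fun h => ⟨fun j hj => (h j hj).1, fun j hj => ?_⟩⟩
  obtain rfl | hj := hj.eq_or_lt
  · exact hd.not_bendAt
  · exact (h j hj).2

lemma isCritical_iff (π : SPath p q n) : π.IsCritical ↔ π.NoEventFrom 0 := by
  rw [noEventFrom_iff]
  refine and_congr ⟨fun h j _ => h j, fun h j => h j (Nat.zero_le _)⟩
    ⟨fun h l _ => h l, fun h l hb => h l ?_ hb⟩
  obtain ⟨i, hi, -⟩ := (bend_iff _ _).1 hb
  omega

lemma isSource_iff (π : SPath p q n) :
    π.IsSource ↔ ∃ i, π.DiagonalAt i ∧ π.NoEventFrom (i + 1) :=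
  ⟨fun ⟨i, hi⟩ => ⟨i, (firstEventDiagonal_iff _ _).1 hi⟩,
    fun ⟨i, hi⟩ => ⟨⟨i, hi.1.lt⟩, (firstEventDiagonal_iff _ _).2 hi⟩⟩

lemma isTarget_iff (π : SPath p q n) :
    π.IsTarget ↔ ∃ i, π.BendAt i ∧ π.NoEventFrom (i + 1) := by
  constructor
  · rintro ⟨k, hk⟩
    obtain ⟨i, -, hi⟩ := (firstEventBend_iff _ _).1 hk
    exact ⟨i, hi⟩
  · rintro ⟨i, hi⟩
    have := hi.1.1
    exact ⟨⟨i + 1, by omega⟩, (firstEventBend_iff _ _).2 ⟨i, rfl, hi⟩⟩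

lemma eq_of_firstEvents {π : SPath p q n} {i j : ℕ} (hi : π.DiagonalAt i ∨ π.BendAt i)
    (hi' : π.NoEventFrom (i + 1)) (hj : π.DiagonalAt j ∨ π.BendAt j)
    (hj' : π.NoEventFrom (j + 1)) : i = j := by
  rcases lt_trichotomy i j with h | h | h
  · have := hi' j h
    tauto
  · exact h
  · have := hj' i h
    tauto

lemma IsSource.not_isTarget {π : SPath p q n} (hs : π.IsSource) : ¬ π.IsTarget := by
  intro ht
  obtain ⟨i, hi, hi'⟩ := (isSource_iff _).1 hs
  obtain ⟨j, hj, hj'⟩ := (isTarget_iff _).1 ht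
  obtain rfl := eq_of_firstEvents (.inl hi) hi' (.inr hj) hj'
  exact hi.not_bendAt hj

lemma isCritical_iff_not_isSource_and_not_isTarget (π : SPath p q n) :
    π.IsCritical ↔ ¬ π.IsSource ∧ ¬ π.IsTarget := by
  rw [isCritical_iff, isSource_iff, isTarget_iff]
  constructor
  · exact fun h => ⟨fun ⟨i, hi, _⟩ => (h i i.zero_le).1 hi, fun ⟨i, hi, _⟩ => (h i i.zero_le).2 hi⟩
  · rintro ⟨hs, ht⟩
    suffices ∀ m ≤ n, π.NoEventFrom (n - m) by simpa using this n le_rfl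
    intro m
    induction m with
    | zero => exact fun _ i hi => ⟨fun h => by have := h.lt; omega, fun h => by have := h.1; omega⟩
    | succ m ih =>
      intro hm i hi
      have ih := ih (by omega)
      obtain rfl | hi := hi.eq_or_lt
      · rw [show n - m = n - (m + 1) + 1 by omega] at ih
        exact ⟨fun h => hs ⟨_, h, ih⟩, fun h => ht ⟨_, h, ih⟩⟩
      · exact ih i (by omega)

end SPath

namespace SPath

variable {p q n : ℕ}

lemma NoEventFrom.x_eq_of_vertical {π : SPath p q n} {m : ℕ} (h : π.NoEventFrom m)
    (hπ : π.Interior) {j : ℕ} (hj : m ≤ j) (hn : j ≤ n) (hv : π.x j = π.x (j + 1)) :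
    π.x j = p := by
  have hconst : ∀ d, j + d ≤ n → π.x (j + d) = π.x j ∧ π.x (j + d) = π.x (j + d + 1) := by
    intro d
    induction d with
    | zero => exact fun _ => ⟨rfl, hv⟩
    | succ d ih =>
      rw [← add_assoc]
      intro hd
      obtain ⟨hx, hv⟩ := ih (by omega)
      refine ⟨hv ▸ hx, ?_⟩
      by_contra hne
      refine (h (j + d + 1) (by omega)).1 ⟨hne, fun hh => ?_⟩
      refine (h (j + d) (by omega)).2 ⟨?_, hv, hh⟩
      by_contra! hlast
      have := π.x_mono (Nat.le_add_right (j + d + 1) 1)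
      have := π.x_le (j + d + 1 + 1)
      have : π.x (j + d + 1) = p := (congrArg π.x (by omega)).trans hπ.x_last
      omega
  have := (hconst (n - j) (by omega)).1
  rw [← this, show j + (n - j) = n by omega, hπ.x_last]

-- Without events the horizontal steps come first, then the vertical ones.
lemma NoEventFrom.coordinates {π : SPath p q n} {m : ℕ} (h : π.NoEventFrom m) (hπ : π.Interior)
    {j : ℕ} (hmj : m ≤ j) (hj : j ≤ n) :
    π.x j = min (π.x m + (j - m)) p ∧ π.y j = π.y m + (π.x m + (j - m) - p) := by
  induction j, hmj using Nat.le_induction with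
  | base =>
    have := π.x_le m
    omega
  | succ j hmj ih =>
    obtain ⟨hx, hy⟩ := ih (by omega)
    obtain ⟨hdiag, -⟩ := h j hmj
    rw [DiagonalAt] at hdiag
    have hstep := π.x_lt_or_y_lt (show j < n by omega)
    have hv := h.x_eq_of_vertical hπ hmj (by omega)
    have hx' := hπ.x_succ_le j
    have hy' := hπ.y_succ_le j
    have hxp := π.x_le (j + 1)
    have := π.x_mono (Nat.le_add_right j 1)
    have := π.y_mono (Nat.le_add_right j 1)
    omega

/-! ### Faces at a bend -/

lemma diagonalAt_face {π : SPath p q (n + 1)} {k : Fin (n + 2)} {i : ℕ} (hk : k ≤ i) :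
    (π.face k).DiagonalAt i ↔ π.DiagonalAt (i + 1) := by
  by_cases hi : i < n
  · rw [DiagonalAt, x_face _ _ (by omega), x_face _ _ (by omega), y_face _ _ (by omega),
      y_face _ _ (by omega), if_neg (by omega), if_neg (by omega), DiagonalAt]
  · exact ⟨fun h => absurd h.lt hi, fun h => absurd h.lt (by omega)⟩

lemma bendAt_face {π : SPath p q (n + 1)} {k : Fin (n + 2)} {i : ℕ} (hk : k ≤ i) :
    (π.face k).BendAt i ↔ π.BendAt (i + 1) := by
  by_cases hi : i + 1 < n
  · rw [BendAt, x_face _ _ (by omega), x_face _ _ (by omega), y_face _ _ (by omega),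
      y_face _ _ (by omega), if_neg (by omega), if_neg (by omega), if_neg (by omega), BendAt,
      add_lt_add_iff_right]
  · exact ⟨fun h => absurd h.1 hi, fun h => absurd h.1 (by omega)⟩

lemma noEventFrom_face {π : SPath p q (n + 1)} {k : Fin (n + 2)} {m : ℕ} (hk : k ≤ m) :
    (π.face k).NoEventFrom m ↔ π.NoEventFrom (m + 1) := by
  constructor
  · intro h i hi
    obtain ⟨i, rfl⟩ := Nat.exists_eq_add_of_le' (show 1 ≤ i by omega)
    rw [← diagonalAt_face (k := k) (by omega), ← bendAt_face (k := k) (by omega)]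
    exact h i (by omega)
  · intro h i hi
    rw [diagonalAt_face (hk.trans hi), bendAt_face (hk.trans hi)]
    exact h (i + 1) (by omega)

lemma BendAt.y_lt {π : SPath p q n} {i : ℕ} (h : π.BendAt i) : π.y i < π.y (i + 1) :=
  (π.x_lt_or_y_lt (i.lt_succ_self.trans h.1)).resolve_left h.2.1.not_lt

lemma BendAt.x_lt {π : SPath p q n} {i : ℕ} (h : π.BendAt i) : π.x (i + 1) < π.x (i + 2) :=
  (π.x_lt_or_y_lt h.1).resolve_right h.2.2.not_lt

lemma BendAt.noEventFrom_succ_iff {π : SPath p q n} {i : ℕ} (h : π.BendAt i) :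
    π.NoEventFrom (i + 1) ↔ π.NoEventFrom (i + 2) := by
  refine ⟨fun h' => h'.mono (i + 1).le_succ, fun h' j hj => ?_⟩
  obtain rfl | hj := hj.eq_or_lt
  · exact ⟨fun hd => hd.2 h.2.2, fun hb => h.x_lt.ne hb.2.1⟩
  · exact h' j hj

lemma BendAt.diagonalAt_face {π : SPath p q (n + 1)} {i : ℕ} (h : π.BendAt i) {k : Fin (n + 2)}
    (hk : (k : ℕ) = i + 1) : (π.face k).DiagonalAt i := by
  have hi := h.1
  rw [DiagonalAt, x_face _ _ (by omega), x_face _ _ (by omega), y_face _ _ (by omega),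
    y_face _ _ (by omega), if_pos (by omega), if_neg (by omega)]
  exact ⟨(h.2.1.trans_lt h.x_lt).ne, (h.y_lt.trans_eq h.2.2).ne⟩

lemma BendAt.noEventFrom_face {π : SPath p q (n + 1)} {i : ℕ} (h : π.BendAt i) {k : Fin (n + 2)}
    (hk : (k : ℕ) = i + 1) : (π.face k).NoEventFrom (i + 1) ↔ π.NoEventFrom (i + 1) := by
  rw [SPath.noEventFrom_face hk.le, h.noEventFrom_succ_iff]

lemma Interior.of_face {π : SPath p q (n + 1)} {k : Fin (n + 2)} (h : (π.face k).Interior) :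
    π.Interior :=
  ⟨.of_comp (g := k.succAbove) h.1, .of_comp (g := k.succAbove) h.2⟩

lemma Interior.face {π : SPath p q (n + 1)} (hπ : π.Interior) {k : Fin (n + 2)} (hk : π.Bend k) :
    (π.face k).Interior := by
  obtain ⟨i, j, rfl, hj, hv, hh⟩ := hk
  refine ⟨surjective_comp_succAbove hπ.1 (Fin.castSucc_lt_succ).ne hv,
    surjective_comp_succAbove hπ.2 (j := j.succ) ?_ ?_⟩
  · exact hj ▸ (Fin.castSucc_lt_succ).ne'
  · exact hj ▸ hh.symm

lemma FirstEventBend.isSource_face {π : SPath p q (n + 1)} {k : Fin (n + 2)}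
    (h : π.FirstEventBend k) : (π.face k).IsSource := by
  obtain ⟨i, hk, hb, hn⟩ := (firstEventBend_iff _ _).1 h
  exact (isSource_iff _).2 ⟨i, hb.diagonalAt_face hk, (hb.noEventFrom_face hk).2 hn⟩

/-- The s-path obtained by replacing the diagonal step number `i` by a vertical step followed by a
horizontal one: the inverse of the suppression of a bend. -/
def insertBend (π : SPath p q n) (i : Fin n) (hi : π.Diagonal i) : SPath p q (n + 1) where
  pt := Fin.insertNth i.succ.castSucc ((π.pt i.castSucc).1, (π.pt i.succ).2) π.pt
  strictMono := by
    have hle : π.pt i.castSucc ≤ π.pt i.succ := π.strictMono.monotone (Fin.castSucc_le_succ i)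
    have hlt : (π.pt i.castSucc).1 < (π.pt i.succ).1 := hle.1.lt_of_ne hi.1
    have hlt' : (π.pt i.castSucc).2 < (π.pt i.succ).2 := hle.2.lt_of_ne hi.2
    refine (Fin.strictMono_insertNth_iff _ _ _).2 ⟨π.strictMono, fun j hj => ?_, fun j hj => ?_⟩
    · have hj : j ≤ i.castSucc := by
        rw [Fin.castSucc_lt_castSucc_iff] at hj
        exact Fin.le_castSucc_iff.2 hj
      exact (π.strictMono.monotone hj).trans_lt (Prod.mk_lt_mk_iff_right.2 hlt')
    · have hj : i.succ ≤ j := Fin.castSucc_le_castSucc_iff.1 hj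
      exact (Prod.mk_lt_mk_iff_left.2 hlt).trans_le (π.strictMono.monotone hj)

lemma face_insertBend (π : SPath p q n) (i : Fin n) (hi : π.Diagonal i) :
    (π.insertBend i hi).face i.succ.castSucc = π :=
  pt_injective (funext fun _ => Fin.insertNth_apply_succAbove (α := fun _ => _) ..)

lemma bendAt_insertBend (π : SPath p q n) (i : Fin n) (hi : π.Diagonal i) :
    (π.insertBend i hi).BendAt i := by
  set ρ := π.insertBend i hi
  have hface : ρ.face i.succ.castSucc = π := π.face_insertBend i hi
  have hpt : ρ.pt i.succ.castSucc = ((π.pt i.castSucc).1, (π.pt i.succ).2) :=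
    Fin.insertNth_apply_same (α := fun _ => _) ..
  have hx : ρ.x i = π.x i := by
    rw [← hface, x_face _ _ (by omega), if_pos (by simp)]
  have hy : ρ.y (i + 2) = π.y (i + 1) := by
    rw [← hface, y_face _ _ (by omega), if_neg (by simp)]
  have hx' : ρ.x (i + 1) = π.x i := by
    have := ρ.x_val i.succ.castSucc
    rwa [hpt, ← x_val] at this
  have hy' : ρ.y (i + 1) = π.y (i + 1) := by
    have := ρ.y_val i.succ.castSucc
    rwa [hpt, ← y_val] at this
  exact ⟨by omega, hx.trans hx'.symm, hy'.trans hy.symm⟩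

lemma insertBend_face {π : SPath p q (n + 1)} {i : Fin n} (h : π.BendAt i)
    (hi : (π.face i.succ.castSucc).Diagonal i) :
    (π.face i.succ.castSucc).insertBend i hi = π := by
  refine pt_injective (?_ : Fin.insertNth (α := fun _ => _) i.succ.castSucc _
    (i.succ.castSucc.removeNth π.pt) = _)
  rw [Fin.insertNth_removeNth, Function.update_eq_self_iff]
  refine Prod.ext (Fin.ext ?_) (Fin.ext ?_)
  · rw [← x_val, ← x_val, x_face _ _ (by simp), if_pos (by simp)]
    exact h.2.1
  · rw [← y_val, ← y_val, y_face _ _ (by simp), if_neg (by simp)]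
    exact h.2.2.symm

lemma IsSource.exists_face_eq {π : SPath p q n} (h : π.IsSource) :
    ∃ (π' : SPath p q (n + 1)) (k : Fin (n + 2)), π'.FirstEventBend k ∧ π'.face k = π := by
  obtain ⟨i, hi⟩ := h
  have hb := π.bendAt_insertBend i hi.1
  refine ⟨π.insertBend i hi.1, i.succ.castSucc, (firstEventBend_iff _ _).2 ⟨i, rfl, hb, ?_⟩,
    π.face_insertBend i hi.1⟩
  rw [← hb.noEventFrom_face (k := i.succ.castSucc) rfl, face_insertBend]
  exact ((firstEventDiagonal_iff _ _).1 hi).2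

lemma FirstEventBend.eq_insertBend {π : SPath p q (n + 1)} {k : Fin (n + 2)}
    (h : π.FirstEventBend k) : ∃ (i : Fin n) (hi : (π.face k).Diagonal i),
      (π.face k).FirstEventDiagonal i ∧ (π.face k).insertBend i hi = π := by
  obtain ⟨i, hk, hb, hn⟩ := (firstEventBend_iff _ _).1 h
  lift i to Fin n using (hb.diagonalAt_face hk).lt
  obtain rfl : k = i.succ.castSucc := Fin.ext hk
  exact ⟨i, (diagonal_iff _ _).2 (hb.diagonalAt_face hk),
    (firstEventDiagonal_iff _ _).2 ⟨hb.diagonalAt_face hk, (hb.noEventFrom_face hk).2 hn⟩,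
    insertBend_face hb _⟩

lemma FirstEventDiagonal.unique {π : SPath p q n} {i j : Fin n} (hi : π.FirstEventDiagonal i)
    (hj : π.FirstEventDiagonal j) : i = j := by
  rw [firstEventDiagonal_iff] at hi hj
  exact Fin.ext (eq_of_firstEvents (.inl hi.1) hi.2 (.inl hj.1) hj.2)

lemma FirstEventBend.unique {π : SPath p q n} {k l : Fin (n + 1)} (hk : π.FirstEventBend k)
    (hl : π.FirstEventBend l) : k = l := by
  obtain ⟨i, hki, hi⟩ := (firstEventBend_iff _ _).1 hk
  obtain ⟨j, hlj, hj⟩ := (firstEventBend_iff _ _).1 hl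
  have := eq_of_firstEvents (.inr hi.1) hi.2 (.inr hj.1) hj.2
  exact Fin.ext (by omega)

lemma FirstEventBend.eq_of_face_eq {π π' : SPath p q (n + 1)} {k k' : Fin (n + 2)}
    (h : π.FirstEventBend k) (h' : π'.FirstEventBend k') (hface : π.face k = π'.face k') :
    π = π' := by
  obtain ⟨i, hi, hfirst, hπ⟩ := h.eq_insertBend
  obtain ⟨i', hi', hfirst', hπ'⟩ := h'.eq_insertBend
  obtain rfl := hfirst.unique (hface ▸ hfirst')
  rw [← hπ, ← hπ']
  congr 1

/-! ### Critical interior s-paths -/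

lemma IsCritical.eq_add {π : SPath p q n} (h : π.IsCritical) (hπ : π.Interior) : n = p + q := by
  obtain ⟨hx, hy⟩ := ((isCritical_iff _).1 h).coordinates hπ n.zero_le le_rfl
  rw [hπ.x_last, hπ.x_zero] at hx
  rw [hπ.y_last, hπ.y_zero, hπ.x_zero] at hy
  omega

lemma IsCritical.eq_last {π : SPath p q (p + q)} (h : π.IsCritical) (hπ : π.Interior) :
    π = last p q := by
  refine pt_injective (funext fun i => ?_)
  obtain ⟨hx, hy⟩ := ((isCritical_iff _).1 h).coordinates hπ (j := i) i.val.zero_le (by omega)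
  rw [hπ.x_zero] at hx
  rw [hπ.x_zero, hπ.y_zero] at hy
  refine Prod.ext (Fin.ext ?_) (Fin.ext ?_)
  · rw [← x_val, hx]
    simp [last]
  · rw [← y_val, hy]
    simp [last]

lemma interior_last (p q : ℕ) : (last p q).Interior :=
  ⟨fun i => ⟨⟨i, by have := i.2; omega⟩, Fin.ext (Nat.min_eq_left (Nat.lt_succ_iff.1 i.2))⟩,
    fun j => ⟨⟨p + j, by have := j.2; omega⟩, Fin.ext (Nat.add_sub_cancel_left ..)⟩⟩

lemma isCritical_last (p q : ℕ) : (last p q).IsCritical := by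
  simp only [IsCritical, Diagonal, Bend, Vertical, Horizontal, last, Fin.ext_iff, Fin.val_castSucc,
    Fin.val_succ]
  refine ⟨fun i => by omega, ?_⟩
  rintro k ⟨i, j, hi, hj, hv, hh⟩
  omega

/-! ### The weight of an s-path -/

/-- The sum over the points of an s-path of the quantities `a + (q - b)`, which grow towards the
lower right corner `(p, 0)` of the lattice. It orders the source s-paths of a given prism so that
the vector field is seen to be admissible. -/
def weight (π : SPath p q n) : ℕ :=
  ∑ i, ((π.pt i).1 + (q - (π.pt i).2) : ℕ)

lemma weight_le (π : SPath p q n) : π.weight ≤ (n + 1) * (p + q) := by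
  refine (Finset.sum_le_card_nsmul _ _ (p + q) fun i _ => ?_).trans_eq (by simp)
  omega

lemma weight_eq_add_weight_face (π : SPath p q (n + 1)) (k : Fin (n + 2)) :
    π.weight = π.x k + (q - π.y k) + (π.face k).weight := by
  rw [x_val, y_val]
  exact Fin.sum_univ_succAbove _ k

-- After the bend an interior face can only skip a point of the horizontal segment, or the corner
-- at its end.
lemma coordinates_of_interior_face {π : SPath p q (n + 1)} {j k : Fin (n + 2)}
    (h : π.NoEventFrom k) (hj : (π.face j).Interior) (hkj : k ≤ j) :
    π.x j = π.x k + (j - k) ∧ π.y j = π.y k := by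
  obtain ⟨hx, hy⟩ := h.coordinates hj.of_face (j := j) hkj (by omega)
  have := π.x_le k
  suffices π.x k + (j - k) ≤ p by omega
  by_contra! hlt
  have hkj : (k : ℕ) < j := by omega
  obtain ⟨-, hy'⟩ := h.coordinates hj.of_face (j := j - 1) (by omega) (by omega)
  have hface := hj.y_succ_le (j - 1)
  rcases eq_or_lt_of_le (Nat.lt_succ_iff.1 j.2) with hlast | hlast
  · have := hj.y_last
    rw [y_face _ _ le_rfl, if_pos (by omega)] at this
    have : π.y j = q := (congrArg π.y hlast).trans hj.of_face.y_last
    rw [show (j : ℕ) - 1 = n by omega] at hy'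
    omega
  · obtain ⟨-, hy''⟩ := h.coordinates hj.of_face (j := j + 1) (by omega) (by omega)
    rw [y_face _ _ (by omega), y_face _ _ (by omega), if_neg (by omega), if_pos (by omega),
      Nat.sub_add_cancel (by omega)] at hface
    omega

lemma isTarget_face_of_add_one_lt {π : SPath p q (n + 1)} {j k : Fin (n + 2)}
    (h : π.FirstEventBend k) (hjk : (j : ℕ) + 1 < k) : (π.face j).IsTarget := by
  obtain ⟨i, hk, hb, hn⟩ := (firstEventBend_iff _ _).1 h
  obtain ⟨i, rfl⟩ := Nat.exists_eq_add_of_le' (show 1 ≤ i by omega)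
  exact (isTarget_iff _).2 ⟨i, (bendAt_face (by omega)).2 hb, (noEventFrom_face (by omega)).2 hn⟩

lemma weight_face_lt {π : SPath p q (n + 1)} {j k : Fin (n + 2)} (h : π.FirstEventBend k)
    (hjk : j ≠ k) (hj : (π.face j).Interior) (hj' : ¬ (π.face j).IsTarget) :
    (π.face j).weight < (π.face k).weight := by
  obtain ⟨i, hk, hb, hn⟩ := (firstEventBend_iff _ _).1 h
  have hweight := (π.weight_eq_add_weight_face k).symm.trans (π.weight_eq_add_weight_face j)
  suffices π.x k + (q - π.y k) < π.x j + (q - π.y j) by omega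
  rcases lt_or_gt_of_ne hjk with hlt | hlt
  · have hji : (j : ℕ) = i := by
      by_contra hne
      exact hj' (isTarget_face_of_add_one_lt h (by omega))
    have := hb.y_lt
    have := π.y_le (i + 1)
    rw [hji, hk, ← hb.2.1]
    omega
  · have := coordinates_of_interior_face (hk ▸ hn) hj hlt.le
    omega

end SPath

/-! ### Non-degenerate simplices of a product -/

section

variable {X : SSet.{u}}

lemma map_section_comp_apply {n m m' : ℕ} {f : ⦋n⦌ ⟶ ⦋m⦌} {f' : ⦋n⦌ ⟶ ⦋m'⦌} (s : SplitEpi f')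
    {σ : X _⦋m⦌} {σ' : X _⦋m'⦌} (h : X.map f.op σ = X.map f'.op σ') :
    X.map (s.section_ ≫ f).op σ = σ' := by
  rw [op_comp, Functor.map_comp, comp_apply, h, ← comp_apply, ← Functor.map_comp, ← op_comp,
    SplitEpi.id, op_id, CategoryTheory.Functor.map_id, id_apply]

lemma dim_le_of_map_eq_map_nonDegenerate {n m m' : ℕ} {f : ⦋n⦌ ⟶ ⦋m⦌} {f' : ⦋n⦌ ⟶ ⦋m'⦌} [Epi f']
    {σ : X _⦋m⦌} {σ' : X.nonDegenerate m'} (h : X.map f.op σ = X.map f'.op σ'.1) : m' ≤ m := by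
  obtain ⟨⟨s⟩⟩ := isSplitEpi_of_epi f'
  have := X.mono_of_nonDegenerate σ' (s.section_ ≫ f) σ (map_section_comp_apply s h)
  exact SimplexCategory.len_le_of_mono (s.section_ ≫ f)

lemma epi_of_map_eq_map_nonDegenerate {n m : ℕ} {f f' : ⦋n⦌ ⟶ ⦋m⦌} [Epi f']
    {σ : X _⦋m⦌} {σ' : X.nonDegenerate m} (h : X.map f.op σ = X.map f'.op σ'.1) : Epi f := by
  obtain ⟨⟨s⟩⟩ := isSplitEpi_of_epi f'
  have := X.mono_of_nonDegenerate σ' (s.section_ ≫ f) σ (map_section_comp_apply s h)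
  exact (SplitEpi.mk s.section_ (SimplexCategory.eq_id_of_mono (s.section_ ≫ f))).epi

lemma eq_of_map_nonDegenerate_eq_σ {n m : ℕ} {f : ⦋n + 1⦌ ⟶ ⦋m⦌} [Epi f] {σ : X.nonDegenerate m}
    {i : Fin (n + 1)} {y : X _⦋n⦌} (h : X.map f.op σ.1 = X.σ i y) :
    f i.castSucc = f i.succ := by
  obtain ⟨m', f', _, σ', rfl⟩ := X.exists_nonDegenerate y
  have h' : X.map f.op σ.1 = X.map (SimplexCategory.σ i ≫ f').op σ'.1 := by
    rw [h, op_comp, Functor.map_comp, comp_apply]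
    rfl
  obtain rfl := X.unique_nonDegenerate_dim _ f σ rfl _ σ' h'
  rw [X.unique_nonDegenerate_map _ f σ rfl _ σ' h']
  change f' (i.predAbove i.castSucc) = f' (i.predAbove i.succ)
  rw [Fin.predAbove_castSucc_self, Fin.predAbove_succ_self]

end

namespace SPath

variable {X Y : SSet.{u}} {p q n : ℕ}

lemma simplex_eq_iff {p' q' : ℕ} {π : SPath p q n} {π' : SPath p' q' n} {σ : X _⦋p⦌} {τ : Y _⦋q⦌}
    {σ' : X _⦋p'⦌} {τ' : Y _⦋q'⦌} : π.simplex σ τ = π'.simplex σ' τ' ↔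
      X.map π.fst.op σ = X.map π'.fst.op σ' ∧ Y.map π.snd.op τ = Y.map π'.snd.op τ' :=
  Prod.mk_inj

lemma interior_iff_epi {π : SPath p q n} : π.Interior ↔ Epi π.fst ∧ Epi π.snd := by
  rw [SimplexCategory.epi_iff_surjective, SimplexCategory.epi_iff_surjective]
  rfl

lemma δ_simplex (π : SPath p q (n + 1)) (j : Fin (n + 2)) (σ : X _⦋p⦌) (τ : Y _⦋q⦌) :
    (X ⊗ Y : SSet.{u}).δ j (π.simplex σ τ) = (π.face j).simplex σ τ := by
  have hfst := ConcreteCategory.congr_hom (X.map_comp π.fst.op (SimplexCategory.δ j).op) σ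
  have hsnd := ConcreteCategory.congr_hom (Y.map_comp π.snd.op (SimplexCategory.δ j).op) τ
  exact Prod.ext hfst.symm hsnd.symm

lemma face_injective (π : SPath p q (n + 1)) : Function.Injective π.face := by
  intro j k h
  by_contra hne
  obtain ⟨i, hi⟩ := Fin.exists_succAbove_eq (Ne.symm hne)
  have h1 : π.pt (j.succAbove i) = π.pt (k.succAbove i) := congrArg (fun π' => SPath.pt π' i) h
  exact Fin.succAbove_ne k i (π.strictMono.injective (hi ▸ h1)).symm

end SPath

/-- The canonical writing of a non-degenerate `n`-simplex of `X × Y`: two non-degenerate simplices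
and an interior s-path in the prism which they span. -/
structure SPathCode (X Y : SSet.{u}) (n : ℕ) where
  p : ℕ
  q : ℕ
  σ : X.nonDegenerate p
  τ : Y.nonDegenerate q
  π : SPath p q n
  interior : π.Interior

namespace SPathCode

variable {X Y : SSet.{u}} {n : ℕ}

/-- The simplex of `X × Y` which is coded. -/
def simplex (c : SPathCode X Y n) : (X ⊗ Y : SSet.{u}) _⦋n⦌ := c.π.simplex c.σ.1 c.τ.1

lemma simplex_injective : Function.Injective (simplex (X := X) (Y := Y) (n := n)) := by
  rintro ⟨p, q, σ, τ, π, hπ⟩ ⟨p', q', σ', τ', π', hπ'⟩ h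
  obtain ⟨hx, hy⟩ := SPath.simplex_eq_iff.1 h
  obtain ⟨_, _⟩ := SPath.interior_iff_epi.1 hπ
  obtain ⟨_, _⟩ := SPath.interior_iff_epi.1 hπ'
  obtain rfl := X.unique_nonDegenerate_dim _ π.fst σ rfl π'.fst σ' hx
  obtain rfl := Y.unique_nonDegenerate_dim _ π.snd τ rfl π'.snd τ' hy
  obtain rfl := X.unique_nonDegenerate_simplex _ π.fst σ rfl π'.fst σ' hx
  obtain rfl := Y.unique_nonDegenerate_simplex _ π.snd τ rfl π'.snd τ' hy
  have hfst := X.unique_nonDegenerate_map _ π.fst σ rfl π'.fst σ hx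
  have hsnd := Y.unique_nonDegenerate_map _ π.snd τ rfl π'.snd τ hy
  obtain rfl : π = π' := SPath.pt_injective <| funext fun i =>
    Prod.ext (SimplexCategory.congr_toOrderHom_apply hfst i)
      (SimplexCategory.congr_toOrderHom_apply hsnd i)
  rfl

lemma simplex_mem_nonDegenerate (c : SPathCode X Y n) :
    c.simplex ∈ (X ⊗ Y : SSet.{u}).nonDegenerate n := by
  intro hd
  obtain _ | n := n
  · rw [SSet.degenerate_zero] at hd
    exact hd
  · rw [SSet.degenerate_eq_iUnion_range_σ, Set.mem_iUnion] at hd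
    obtain ⟨i, y, hy⟩ := hd
    obtain ⟨_, _⟩ := SPath.interior_iff_epi.1 c.interior
    have hfst : c.π.fst i.castSucc = c.π.fst i.succ :=
      eq_of_map_nonDegenerate_eq_σ (y := y.1) (congrArg Prod.fst hy.symm)
    have hsnd : c.π.snd i.castSucc = c.π.snd i.succ :=
      eq_of_map_nonDegenerate_eq_σ (y := y.2) (congrArg Prod.snd hy.symm)
    exact (c.π.strictMono i.castSucc_lt_succ).ne (Prod.ext hfst hsnd)

lemma strictMono_of_map_mem_nonDegenerate {p q : ℕ} {f : ⦋n⦌ ⟶ ⦋p⦌} {g : ⦋n⦌ ⟶ ⦋q⦌} {σ : X _⦋p⦌}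
    {τ : Y _⦋q⦌} (h : (X.map f.op σ, Y.map g.op τ) ∈ (X ⊗ Y : SSet.{u}).nonDegenerate n) :
    StrictMono fun i : Fin (n + 1) => (f i, g i) := by
  obtain _ | n := n
  · exact fun a b hab => absurd hab (by omega)
  · refine Fin.strictMono_iff_lt_succ.2 fun i => lt_of_le_of_ne
      ⟨f.toOrderHom.monotone i.castSucc_lt_succ.le, g.toOrderHom.monotone i.castSucc_lt_succ.le⟩
      fun e => h ?_
    rw [Prod.mk_inj] at e
    obtain ⟨f', rfl⟩ := SimplexCategory.eq_σ_comp_of_not_injective' f i e.1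
    obtain ⟨g', rfl⟩ := SimplexCategory.eq_σ_comp_of_not_injective' g i e.2
    rw [op_comp, Functor.map_comp, comp_apply, op_comp, Functor.map_comp, comp_apply]
    exact (X ⊗ Y : SSet.{u}).σ_mem_degenerate i (X.map f'.op σ, Y.map g'.op τ)

lemma exists_simplex_eq (ρ : (X ⊗ Y : SSet.{u}).nonDegenerate n) :
    ∃ c : SPathCode X Y n, c.simplex = ρ.1 := by
  obtain ⟨⟨x, y⟩, hρ⟩ := ρ
  obtain ⟨p, f, hf, σ, rfl⟩ := X.exists_nonDegenerate x
  obtain ⟨q, g, hg, τ, rfl⟩ := Y.exists_nonDegenerate y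
  let π : SPath p q n := ⟨fun i => (f i, g i), strictMono_of_map_mem_nonDegenerate hρ⟩
  have hfst : π.fst = f := by ext; rfl
  have hsnd : π.snd = g := by ext; rfl
  refine ⟨⟨p, q, σ, τ, π, SPath.interior_iff_epi.2 ⟨hfst ▸ hf, hsnd ▸ hg⟩⟩, ?_⟩
  exact Prod.ext (congrArg (fun h => X.map (Quiver.Hom.op h) σ.1) hfst)
    (congrArg (fun h => Y.map (Quiver.Hom.op h) τ.1) hsnd)

/-- The non-degenerate simplices of `X × Y` correspond to their codes. -/
noncomputable def equivNonDegenerate (X Y : SSet.{u}) (n : ℕ) :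
    SPathCode X Y n ≃ (X ⊗ Y : SSet.{u}).nonDegenerate n :=
  .ofBijective (fun c => ⟨c.simplex, c.simplex_mem_nonDegenerate⟩)
    ⟨fun _ _ h => simplex_injective (congrArg Subtype.val h),
      fun ρ => (exists_simplex_eq ρ).imp fun _ h => Subtype.ext h⟩

lemma hasSPath_iff (c : SPathCode X Y n) (P : ∀ {p q : ℕ}, SPath p q n → Prop) :
    HasSPath c.simplex P ↔ P c.π := by
  constructor
  · rintro ⟨p, q, σ, τ, π, hπ, e, h⟩
    obtain rfl : c = ⟨p, q, σ, τ, π, hπ⟩ := simplex_injective e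
    exact h
  · exact fun h => ⟨_, _, _, _, _, c.interior, rfl, h⟩

/-- The code of a face which is interior to the same prism. -/
abbrev face (c : SPathCode X Y (n + 1)) (j : Fin (n + 2)) (hj : (c.π.face j).Interior) :
    SPathCode X Y n :=
  ⟨c.p, c.q, c.σ, c.τ, c.π.face j, hj⟩

-- A face is either interior to the same prism, or contained in its boundary, hence in a smaller
-- prism.
lemma lt_or_eq_face_of_δ_simplex_eq {c : SPathCode X Y (n + 1)} {c' : SPathCode X Y n}
    {j : Fin (n + 2)} (h : (X ⊗ Y : SSet.{u}).δ j c.simplex = c'.simplex) :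
    c'.p + c'.q < c.p + c.q ∨ ∃ hj, c' = c.face j hj := by
  have e : (c.π.face j).simplex c.σ.1 c.τ.1 = c'.simplex := (c.π.δ_simplex j _ _).symm.trans h
  obtain ⟨p', q', σ', τ', π', hπ'⟩ := c'
  obtain ⟨p, q, σ, τ, π, hπ⟩ := c
  obtain ⟨hx, hy⟩ := SPath.simplex_eq_iff.1 e
  obtain ⟨_, _⟩ := SPath.interior_iff_epi.1 hπ'
  have hp : p' ≤ p := dim_le_of_map_eq_map_nonDegenerate hx
  have hq : q' ≤ q := dim_le_of_map_eq_map_nonDegenerate hy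
  refine or_iff_not_imp_left.2 fun hlt => ?_
  obtain rfl : p' = p := by dsimp only at hlt; omega
  obtain rfl : q' = q := by dsimp only at hlt; omega
  have hj := SPath.interior_iff_epi.2
    ⟨epi_of_map_eq_map_nonDegenerate hx, epi_of_map_eq_map_nonDegenerate hy⟩
  exact ⟨hj, simplex_injective e.symm⟩

lemma face_eq_face_iff {c : SPathCode X Y (n + 1)} {j k : Fin (n + 2)}
    {hj : (c.π.face j).Interior} {hk : (c.π.face k).Interior} :
    c.face j hj = c.face k hk ↔ j = k := by
  simp only [face, mk.injEq, heq_eq_eq, true_and, c.π.face_injective.eq_iff]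

lemma δ_simplex_eq_simplex_face_iff {c : SPathCode X Y (n + 1)} {j k : Fin (n + 2)}
    {hk : (c.π.face k).Interior} :
    (X ⊗ Y : SSet.{u}).δ j c.simplex = (c.face k hk).simplex ↔ j = k := by
  constructor
  · intro e
    rcases lt_or_eq_face_of_δ_simplex_eq e with hlt | ⟨hj, e'⟩
    · exact absurd hlt (lt_irrefl _)
    · exact (face_eq_face_iff.1 e').symm
  · rintro rfl
    exact c.π.δ_simplex j _ _

/-- The rank of a simplex of dimension `n`: the dimension of its prism prevails over the weight of
its s-path, which is at most `(n + 1) * (p + q)`. -/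
def rank (c : SPathCode X Y n) : ℕ := (n + 1) * (c.p + c.q + 1) ^ 2 + c.π.weight

lemma rank_lt_of_dim_lt {c c' : SPathCode X Y n} (h : c'.p + c'.q < c.p + c.q) :
    c'.rank < c.rank := by
  calc
    c'.rank ≤ (n + 1) * (c'.p + c'.q + 1) ^ 2 + (n + 1) * (c'.p + c'.q) :=
      Nat.add_le_add_left c'.π.weight_le _
    _ < (n + 1) * (c'.p + c'.q + 2) ^ 2 := by nlinarith
    _ ≤ (n + 1) * (c.p + c.q + 1) ^ 2 :=
      Nat.mul_le_mul_left _ (Nat.pow_le_pow_left (by omega) 2)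
    _ ≤ c.rank := Nat.le_add_right ..

lemma rank_lt_rank_face {c : SPathCode X Y (n + 1)} {c' : SPathCode X Y n} {j k : Fin (n + 2)}
    (h : c.π.FirstEventBend k) {hk : (c.π.face k).Interior} (hs : c'.π.IsSource)
    (hne : c' ≠ c.face k hk) (e : (X ⊗ Y : SSet.{u}).δ j c.simplex = c'.simplex) :
    c'.rank < (c.face k hk).rank := by
  rcases lt_or_eq_face_of_δ_simplex_eq e with hlt | ⟨hj, rfl⟩
  · exact rank_lt_of_dim_lt hlt
  · have hjk : j ≠ k := mt face_eq_face_iff.2 hne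
    exact Nat.add_lt_add_left (SPath.weight_face_lt h hjk hj hs.not_isTarget) _

end SPathCode

/-! ### Incidence numbers of the normalized chain complex -/

section

variable (k : Type) [CommRing k] {X : SSet.{u}} {n : ℕ}

lemma normGen_eq_zero {x : X _⦋n⦌} (hx : x ∈ X.degenerate n) : X.normGen k x = 0 := by
  rw [SSet.normGen, SSet.ιNormalizedChainComplex_eq_zero _ _ hx]
  rfl

lemma d_normGen (x : X _⦋n + 1⦌) :
    ((X.normalizedChainComplex (SSet.coeff.{u} k)).d (n + 1) n).hom (X.normGen k x) =
      ∑ i : Fin (n + 2), (-1 : ℤ) ^ (i : ℕ) • X.normGen k (X.δ i x) := by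
  refine (congrArg (fun f => f.hom (ULift.up 1))
    (X.ιNormalizedChainComplex_d (R := SSet.coeff.{u} k) x)).trans ?_
  simp only [ModuleCat.hom_sum, LinearMap.sum_apply]
  rfl

open Classical in
lemma normBasis_repr_normGen (x : X _⦋n⦌) (ρ : X.nonDegenerate n) :
    (X.normBasis k n).repr (X.normGen k x) ρ = if x = ρ.1 then 1 else 0 := by
  by_cases hx : x ∈ X.nonDegenerate n
  · rw [← X.normBasis_apply k ⟨x, hx⟩, Module.Basis.repr_self, Finsupp.single_apply]
    simp only [Subtype.ext_iff]
  · rw [normGen_eq_zero k ((X.mem_degenerate_iff_notMem_nonDegenerate x).2 hx), map_zero,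
      if_neg fun e : x = ρ.1 => hx (e ▸ ρ.2)]
    rfl

open Classical in
lemma incidence_normalizedACC (ρ : X.nonDegenerate n) (ρ' : X.nonDegenerate (n + 1)) :
    (X.normalizedACC k).incidence (p := n) ρ ρ' =
      ∑ i : Fin (n + 2), if X.δ i ρ'.1 = ρ.1 then (-1 : k) ^ (i : ℕ) else 0 := by
  change (X.normBasis k n).repr (((X.normalizedChainComplex (SSet.coeff.{u} k)).d (n + 1) n).hom
    (X.normBasis k (n + 1) ρ')) ρ = _
  rw [SSet.normBasis_apply, d_normGen, map_sum, Finsupp.finsetSum_apply]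
  refine Finset.sum_congr rfl fun i _ => ?_
  rw [map_zsmul, Finsupp.smul_apply, normBasis_repr_normGen]
  simp

lemma exists_δ_eq_of_isFace {ρ : X.nonDegenerate n} {ρ' : X.nonDegenerate (n + 1)}
    (h : (X.normalizedACC k).IsFace (p := n) ρ ρ') : ∃ j, X.δ j ρ'.1 = ρ.1 := by
  classical
  obtain ⟨j, -, hj⟩ := Finset.exists_ne_zero_of_sum_ne_zero
    ((incidence_normalizedACC k ρ ρ').symm.trans_ne h)
  exact ⟨j, of_not_not fun hne => hj (if_neg hne)⟩

lemma isRegularFace_of_δ_eq_iff {ρ : X.nonDegenerate n} {ρ' : X.nonDegenerate (n + 1)}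
    {i : Fin (n + 2)} (h : ∀ j, X.δ j ρ'.1 = ρ.1 ↔ j = i) :
    (X.normalizedACC k).IsRegularFace (p := n) ρ ρ' := by
  classical
  simp only [AlgCellComplex.IsRegularFace, incidence_normalizedACC, h, Finset.sum_ite_eq',
    Finset.mem_univ, if_true]
  exact neg_one_pow_eq_or k i

end

/-! ### The Eilenberg-Zilber vector field -/

/-- The Eilenberg-Zilber vector field, over any ring of coefficients: its vectors do not depend on
the coefficients. -/
def ezVectorFieldOver (k : Type) [CommRing k] (X Y : SSet.{u}) :
    (SSet.normalizedACC k (X ⊗ Y)).PairField :=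
  ezVectorField X Y

section

open AlgCellComplex SPathCode

variable {k : Type} [CommRing k] {X Y : SSet.{u}} {n : ℕ}

lemma ezVectorFieldOver_iff {c : SPathCode X Y n} {c' : SPathCode X Y (n + 1)} :
    ezVectorFieldOver k X Y n (equivNonDegenerate X Y n c) (equivNonDegenerate X Y (n + 1) c') ↔
      ∃ i, ∃ h : c'.π.FirstEventBend i, c = c'.face i (c'.interior.face h.1) := by
  constructor
  · rintro ⟨p, q, σ, τ, π, i, hπ, hi, e', e⟩
    obtain rfl : c' = ⟨p, q, σ, τ, π, hπ⟩ := simplex_injective e'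
    exact ⟨i, hi, simplex_injective e⟩
  · rintro ⟨i, hi, rfl⟩
    exact ⟨_, _, _, _, _, i, c'.interior, hi, rfl, rfl⟩

lemma mem_sources_ezVectorFieldOver {c : SPathCode X Y n} :
    equivNonDegenerate X Y n c ∈ sources (ezVectorFieldOver k X Y) n ↔ c.π.IsSource := by
  constructor
  · rintro ⟨ρ', h⟩
    obtain ⟨c', rfl⟩ := (equivNonDegenerate X Y (n + 1)).surjective ρ'
    obtain ⟨i, hi, rfl⟩ := ezVectorFieldOver_iff.1 h
    exact hi.isSource_face
  · intro h
    obtain ⟨p, q, σ, τ, π, hπ⟩ := c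
    obtain ⟨π', i, hi, rfl⟩ := SPath.IsSource.exists_face_eq (π := π) h
    exact ⟨equivNonDegenerate X Y (n + 1) ⟨p, q, σ, τ, π', hπ.of_face⟩,
      ezVectorFieldOver_iff.2 ⟨i, hi, rfl⟩⟩

lemma mem_targets_ezVectorFieldOver {c : SPathCode X Y n} :
    equivNonDegenerate X Y n c ∈ targets (ezVectorFieldOver k X Y) n ↔ c.π.IsTarget := by
  obtain _ | n := n
  · refine ⟨fun h => h.elim, ?_⟩
    rintro ⟨_, ⟨i, -⟩, -⟩
    exact i.elim0
  · constructor
    · rintro ⟨ρ, h⟩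
      obtain ⟨c', rfl⟩ := (equivNonDegenerate X Y n).surjective ρ
      obtain ⟨i, hi, -⟩ := ezVectorFieldOver_iff.1 h
      exact ⟨i, hi⟩
    · rintro ⟨i, hi⟩
      exact ⟨equivNonDegenerate X Y n (c.face i (c.interior.face hi.1)),
        ezVectorFieldOver_iff.2 ⟨i, hi, rfl⟩⟩

lemma mem_criticals_ezVectorFieldOver {c : SPathCode X Y n} :
    equivNonDegenerate X Y n c ∈ criticals (ezVectorFieldOver k X Y) n ↔ c.π.IsCritical := by
  rw [SPath.isCritical_iff_not_isSource_and_not_isTarget, ← mem_sources_ezVectorFieldOver (k := k),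
    ← mem_targets_ezVectorFieldOver (k := k), ← not_or]
  rfl

lemma isRegularFace_of_ezVectorFieldOver {ρ : (X ⊗ Y : SSet.{u}).nonDegenerate n}
    {ρ' : (X ⊗ Y : SSet.{u}).nonDegenerate (n + 1)} (h : ezVectorFieldOver k X Y n ρ ρ') :
    (SSet.normalizedACC k (X ⊗ Y)).IsRegularFace (p := n) ρ ρ' := by
  obtain ⟨c, rfl⟩ := (equivNonDegenerate X Y n).surjective ρ
  obtain ⟨c', rfl⟩ := (equivNonDegenerate X Y (n + 1)).surjective ρ'
  obtain ⟨i, hi, rfl⟩ := ezVectorFieldOver_iff.1 h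
  exact isRegularFace_of_δ_eq_iff k fun j => δ_simplex_eq_simplex_face_iff

lemma eq_of_ezVectorFieldOver_left {ρ : (X ⊗ Y : SSet.{u}).nonDegenerate n}
    {ρ₁ ρ₂ : (X ⊗ Y : SSet.{u}).nonDegenerate (n + 1)} (h₁ : ezVectorFieldOver k X Y n ρ ρ₁)
    (h₂ : ezVectorFieldOver k X Y n ρ ρ₂) : ρ₁ = ρ₂ := by
  obtain ⟨c, rfl⟩ := (equivNonDegenerate X Y n).surjective ρ
  obtain ⟨⟨p, q, σ, τ, π, hπ⟩, rfl⟩ := (equivNonDegenerate X Y (n + 1)).surjective ρ₁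
  obtain ⟨⟨p', q', σ', τ', π', hπ'⟩, rfl⟩ := (equivNonDegenerate X Y (n + 1)).surjective ρ₂
  obtain ⟨i, hi, rfl⟩ := ezVectorFieldOver_iff.1 h₁
  obtain ⟨j, hj, e⟩ := ezVectorFieldOver_iff.1 h₂
  simp only [SPathCode.face, SPathCode.mk.injEq] at e
  obtain ⟨rfl, rfl, ⟨⟩, ⟨⟩, e⟩ := e
  obtain rfl := hi.eq_of_face_eq hj (eq_of_heq e)
  rfl

lemma eq_of_ezVectorFieldOver_right {ρ₁ ρ₂ : (X ⊗ Y : SSet.{u}).nonDegenerate n}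
    {ρ : (X ⊗ Y : SSet.{u}).nonDegenerate (n + 1)} (h₁ : ezVectorFieldOver k X Y n ρ₁ ρ)
    (h₂ : ezVectorFieldOver k X Y n ρ₂ ρ) : ρ₁ = ρ₂ := by
  obtain ⟨c₁, rfl⟩ := (equivNonDegenerate X Y n).surjective ρ₁
  obtain ⟨c₂, rfl⟩ := (equivNonDegenerate X Y n).surjective ρ₂
  obtain ⟨c, rfl⟩ := (equivNonDegenerate X Y (n + 1)).surjective ρ
  obtain ⟨i, hi, rfl⟩ := ezVectorFieldOver_iff.1 h₁
  obtain ⟨j, hj, rfl⟩ := ezVectorFieldOver_iff.1 h₂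
  obtain rfl := hi.unique hj
  rfl

variable (k X Y)

lemma isDiscreteVectorField_ezVectorFieldOver :
    IsDiscreteVectorField (ezVectorFieldOver k X Y) where
  regular _ _ _ := isRegularFace_of_ezVectorFieldOver
  target_unique _ _ _ _ := eq_of_ezVectorFieldOver_left
  source_unique _ _ _ _ := eq_of_ezVectorFieldOver_right
  disjoint n := Set.disjoint_left.2 fun ρ hs ht => by
    obtain ⟨c, rfl⟩ := (equivNonDegenerate X Y n).surjective ρ
    exact (mem_sources_ezVectorFieldOver.1 hs).not_isTarget (mem_targets_ezVectorFieldOver.1 ht)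

lemma isRank_ezVectorFieldOver :
    IsRank (ezVectorFieldOver k X Y) fun n ρ => ((equivNonDegenerate X Y n).symm ρ).rank := by
  intro n ρ ρ₁ ρ' h hs hf hne
  obtain ⟨c, rfl⟩ := (equivNonDegenerate X Y n).surjective ρ
  obtain ⟨c₁, rfl⟩ := (equivNonDegenerate X Y n).surjective ρ₁
  obtain ⟨c', rfl⟩ := (equivNonDegenerate X Y (n + 1)).surjective ρ'
  obtain ⟨i, hi, rfl⟩ := ezVectorFieldOver_iff.1 h
  obtain ⟨j, hj⟩ := exists_δ_eq_of_isFace k hf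
  simp only [Equiv.symm_apply_apply]
  exact rank_lt_rank_face hi (mem_sources_ezVectorFieldOver.1 hs)
    (fun e => hne (congrArg _ e)) hj

end

/-! ### Tensor products of chain complexes -/

section

open HomologicalComplex

variable {k : Type} [CommRing k] {K L : ChainComplex (ModuleCat.{u} k) ℕ} {p q n m : ℕ}

/-- The bilinear map `(x, y) ↦ x ⊗ y`, with values in the chains of degree `n = p + q` of the
tensor product. Its equality argument avoids casts between degrees which are only propositionally
equal. -/
noncomputable def tmulDeg (h : p + q = n) :
    K.X p →ₗ[k] L.X q →ₗ[k] (tensorComplex K L).X n :=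
  (TensorProduct.mk k (K.X p) (L.X q)).compr₂
    (ιMapBifunctor K L (tensorBifunctor k) (ComplexShape.down ℕ) p q n h).hom

lemma D₁_tmulDeg_zero (h : 0 + q = n) (x : K.X 0) (y : L.X q) :
    (mapBifunctor.D₁ K L (tensorBifunctor k) (ComplexShape.down ℕ) n m).hom (tmulDeg h x y) =
      0 := by
  have := mapBifunctor.ι_D₁ K L (tensorBifunctor k) (ComplexShape.down ℕ) n m 0 q h
  rw [mapBifunctor.d₁_eq_zero _ _ _ _ _ _ _ (by simp)] at this
  exact congrArg (fun f => f.hom (x ⊗ₜ[k] y)) this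

lemma D₂_tmulDeg_zero (h : p + 0 = n) (x : K.X p) (y : L.X 0) :
    (mapBifunctor.D₂ K L (tensorBifunctor k) (ComplexShape.down ℕ) n m).hom (tmulDeg h x y) =
      0 := by
  have := mapBifunctor.ι_D₂ K L (tensorBifunctor k) (ComplexShape.down ℕ) n m p 0 h
  rw [mapBifunctor.d₂_eq_zero _ _ _ _ _ _ _ (by simp)] at this
  exact congrArg (fun f => f.hom (x ⊗ₜ[k] y)) this

lemma D₁_tmulDeg_succ (h : p + 1 + q = n) (h' : p + q = m) (x : K.X (p + 1)) (y : L.X q) :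
    (mapBifunctor.D₁ K L (tensorBifunctor k) (ComplexShape.down ℕ) n m).hom (tmulDeg h x y) =
      tmulDeg h' ((K.d (p + 1) p).hom x) y := by
  have := mapBifunctor.ι_D₁ K L (tensorBifunctor k) (ComplexShape.down ℕ) n m (p + 1) q h
  rw [mapBifunctor.d₁_eq K L (tensorBifunctor k) (ComplexShape.down ℕ)
    (show (ComplexShape.down ℕ).Rel (p + 1) p from rfl) q m h',
    show ComplexShape.ε₁ (ComplexShape.down ℕ) (ComplexShape.down ℕ) (ComplexShape.down ℕ)
      (p + 1, q) = 1 from rfl, one_smul] at this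
  exact congrArg (fun f => f.hom (x ⊗ₜ[k] y)) this

lemma D₂_tmulDeg_succ (h : p + (q + 1) = n) (h' : p + q = m) (x : K.X p) (y : L.X (q + 1)) :
    (mapBifunctor.D₂ K L (tensorBifunctor k) (ComplexShape.down ℕ) n m).hom (tmulDeg h x y) =
      (-1 : ℤ) ^ p • tmulDeg h' x ((L.d (q + 1) q).hom y) := by
  have := mapBifunctor.ι_D₂ K L (tensorBifunctor k) (ComplexShape.down ℕ) n m p (q + 1) h
  rw [mapBifunctor.d₂_eq K L (tensorBifunctor k) (ComplexShape.down ℕ)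
    p (show (ComplexShape.down ℕ).Rel (q + 1) q from rfl) m h'] at this
  refine (congrArg (fun f => f.hom (x ⊗ₜ[k] y)) this).trans ?_
  simp only [ComplexShape.ε₂_def, ComplexShape.ε_down_ℕ, ModuleCat.hom_smul, ModuleCat.hom_comp,
    LinearMap.coe_smul, LinearMap.coe_comp]
  rfl

lemma tensorComplex_linearMap_ext {M : Type u} [AddCommGroup M] [Module k M]
    {f g : (tensorComplex K L).X n →ₗ[k] M}
    (h : ∀ {p q} (h : p + q = n), (tmulDeg (K := K) (L := L) h).compr₂ f = (tmulDeg h).compr₂ g) :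
    f = g := by
  suffices ModuleCat.ofHom f = ModuleCat.ofHom g from congrArg ModuleCat.Hom.hom this
  exact mapBifunctor.hom_ext fun p q hpq =>
    ModuleCat.hom_ext (TensorProduct.ext (h hpq))

/-- The linear map on the tensor product which is determined by bilinear maps on its summands. -/
noncomputable def tensorDesc {M : Type u} [AddCommGroup M] [Module k M]
    (f : ∀ p q, p + q = n → K.X p →ₗ[k] L.X q →ₗ[k] M) : (tensorComplex K L).X n →ₗ[k] M :=
  (mapBifunctorDesc (A := ModuleCat.of k M) (F := tensorBifunctor k) (c := ComplexShape.down ℕ)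
    fun p q h => ModuleCat.ofHom (TensorProduct.lift (f p q h))).hom

lemma tensorDesc_tmulDeg {M : Type u} [AddCommGroup M] [Module k M]
    (f : ∀ p q, p + q = n → K.X p →ₗ[k] L.X q →ₗ[k] M) (h : p + q = n) (x : K.X p) (y : L.X q) :
    tensorDesc f (tmulDeg h x y) = f p q h x y :=
  congrArg (fun g => g.hom (x ⊗ₜ[k] y)) (ι_mapBifunctorDesc (A := ModuleCat.of k M)
    (F := tensorBifunctor k) (c := ComplexShape.down ℕ)
    (fun p q h => ModuleCat.ofHom (TensorProduct.lift (f p q h))) p q h)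

variable {ι κ : ℕ → Type u} (bK : ∀ p, Module.Basis (ι p) k (K.X p))
  (bL : ∀ q, Module.Basis (κ q) k (L.X q))

/-- The coordinates of the chains of a tensor product with respect to the elements
`bK p i ⊗ bL q j`. -/
noncomputable def tensorCoord (n : ℕ) : (tensorComplex K L).X n →ₗ[k]
    ((Σ pq : {pq : ℕ × ℕ // pq.1 + pq.2 = n}, ι pq.1.1 × κ pq.1.2) →₀ k) :=
  tensorDesc fun p q h => (bK p).constr k fun i => (bL q).constr k fun j =>
    Finsupp.single ⟨⟨(p, q), h⟩, i, j⟩ 1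

lemma tensorCoord_tmulDeg (h : p + q = n) (i : ι p) (j : κ q) :
    tensorCoord bK bL n (tmulDeg h (bK p i) (bL q j)) = Finsupp.single ⟨⟨(p, q), h⟩, i, j⟩ 1 := by
  rw [tensorCoord, tensorDesc_tmulDeg, Module.Basis.constr_basis, Module.Basis.constr_basis]

/-- The basis of the `n`-chains of a tensor product made of the elements `bK p i ⊗ bL q j` for
`p + q = n`. -/
noncomputable def tensorBasis (n : ℕ) :
    Module.Basis (Σ pq : {pq : ℕ × ℕ // pq.1 + pq.2 = n}, ι pq.1.1 × κ pq.1.2) k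
      ((tensorComplex K L).X n) :=
  .ofRepr <| LinearEquiv.ofLinearMap (tensorCoord bK bL n)
    (Finsupp.linearCombination k fun e => tmulDeg e.1.2 (bK _ e.2.1) (bL _ e.2.2))
    (by
      refine Finsupp.lhom_ext' fun e => LinearMap.ext_ring ?_
      simp [tensorCoord_tmulDeg])
    (by
      refine tensorComplex_linearMap_ext fun {p q} h => (bK p).ext fun i => (bL q).ext fun j => ?_
      simp [tensorCoord_tmulDeg])

lemma tensorBasis_apply (h : p + q = n) (i : ι p) (j : κ q) :
    tensorBasis bK bL n ⟨⟨(p, q), h⟩, i, j⟩ = tmulDeg h (bK p i) (bL q j) := by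
  simp [tensorBasis]

end

/-! ### The Alexander-Whitney map -/

section

open SimplexCategory

variable {a l n : ℕ}

lemma subinterval_comp_δ_of_le (h : a + l ≤ n) {j : Fin (n + 2)} (hj : (j : ℕ) ≤ a) :
    subinterval a l h ≫ δ j = subinterval (a + 1) l (by omega) := by
  ext i : 3
  refine (Fin.succAbove_of_le_castSucc j _ (Fin.le_def.2 ?_)).trans (Fin.ext ?_)
  · exact hj.trans (Nat.le_add_left a i)
  · exact Nat.add_assoc _ _ _

lemma subinterval_comp_δ_of_lt (h : a + l ≤ n) {j : Fin (n + 2)} (hj : a + l < j) :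
    subinterval a l h ≫ δ j = subinterval a l (by omega) := by
  ext i : 3
  have hi : (i : ℕ) < l + 1 := i.is_lt
  exact Fin.succAbove_of_castSucc_lt j _ (Fin.lt_def.2 (show (i : ℕ) + a < j by omega))

lemma subinterval_comp_δ_of_eq (h : a + l ≤ n) {j : Fin (n + 2)} {i : Fin (l + 2)}
    (hj : (j : ℕ) = a + i) :
    subinterval a l h ≫ δ j = δ i ≫ subinterval a (l + 1) (by omega) := by
  ext r : 3
  refine Fin.ext ?_
  have hr : (r : ℕ) < l + 1 := r.is_lt
  change (j.succAbove ⟨(r : ℕ) + a, by omega⟩ : ℕ) = (i.succAbove r : ℕ) + a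
  simp only [Fin.succAbove, Fin.lt_def, Fin.val_castSucc]
  split_ifs <;> simp only [Fin.val_castSucc, Fin.val_succ] <;> omega

end

lemma sum_fin_eq_sum_add_sum {M : Type*} [AddCommMonoid M] {a b c : ℕ} (h : a + b = c)
    (F : Fin c → M) :
    ∑ j, F j = ∑ i : Fin a, F ⟨i, by omega⟩ + ∑ i : Fin b, F ⟨a + i, by omega⟩ := by
  subst h
  exact Fin.sum_univ_add F

section

variable {X Y : SSet.{u}} {p q m n : ℕ}

/-- The front face of dimension `p` of a simplex of dimension `p + q`: the one of the first `p + 1`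
vertices. -/
def frontFace (p q : ℕ) (x : X _⦋n⦌) (h : p + q = n := by omega) : X _⦋p⦌ :=
  X.map (SimplexCategory.subinterval 0 p (by omega)).op x

/-- The back face of dimension `q` of a simplex of dimension `p + q`: the one of the last `q + 1`
vertices. -/
def backFace (p q : ℕ) (x : X _⦋n⦌) (h : p + q = n := by omega) : X _⦋q⦌ :=
  X.map (SimplexCategory.subinterval p q h.le).op x

lemma map_op_map_op {f : ⦋p⦌ ⟶ ⦋m⦌} {g : ⦋m⦌ ⟶ ⦋n⦌} (x : X _⦋n⦌) :
    X.map f.op (X.map g.op x) = X.map (f ≫ g).op x := by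
  rw [op_comp, Functor.map_comp, comp_apply]

lemma frontFace_δ_of_eq (h : p + q = n) {j : Fin (n + 2)} {i : Fin (p + 2)} (hj : (j : ℕ) = i)
    (x : X _⦋n + 1⦌) : frontFace p q (X.δ j x) = X.δ i (frontFace (p + 1) q x) := by
  refine (map_op_map_op x).trans (Eq.trans ?_ (map_op_map_op x).symm)
  rw [subinterval_comp_δ_of_eq _ (hj.trans (Nat.zero_add _).symm)]

lemma frontFace_δ_of_lt (h : p + q = n) {j : Fin (n + 2)} (hj : p < j) (x : X _⦋n + 1⦌) :
    frontFace p q (X.δ j x) = frontFace p (q + 1) x := by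
  refine (map_op_map_op x).trans ?_
  rw [subinterval_comp_δ_of_lt _ (by omega), frontFace]

lemma backFace_δ_of_le (h : p + q = n) {j : Fin (n + 2)} (hj : (j : ℕ) ≤ p) (x : X _⦋n + 1⦌) :
    backFace p q (X.δ j x) = backFace (p + 1) q x := by
  refine (map_op_map_op x).trans ?_
  rw [subinterval_comp_δ_of_le _ hj, backFace]

lemma backFace_δ_of_eq (h : p + q = n) {j : Fin (n + 2)} {i : Fin (q + 2)} (hj : (j : ℕ) = p + i)
    (x : X _⦋n + 1⦌) : backFace p q (X.δ j x) = X.δ i (backFace p (q + 1) x) := by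
  refine (map_op_map_op x).trans (Eq.trans ?_ (map_op_map_op x).symm)
  rw [subinterval_comp_δ_of_eq _ hj]

-- On the right, the last term of the first sum and the first term of the second one cancel.
lemma sum_frontFace_backFace_δ {M : Type*} [AddCommGroup M] (h : p + q = n)
    (T : X _⦋p⦌ → Y _⦋q⦌ → M) (x : X _⦋n + 1⦌) (y : Y _⦋n + 1⦌) :
    ∑ j : Fin (n + 2), (-1 : ℤ) ^ (j : ℕ) • T (frontFace p q (X.δ j x)) (backFace p q (Y.δ j y)) =
      ∑ i : Fin (p + 2), (-1 : ℤ) ^ (i : ℕ) •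
        T (X.δ i (frontFace (p + 1) q x)) (backFace (p + 1) q y) +
      (-1 : ℤ) ^ p • ∑ i : Fin (q + 2), (-1 : ℤ) ^ (i : ℕ) •
        T (frontFace p (q + 1) x) (Y.δ i (backFace p (q + 1) y)) := by
  have front_last : X.δ (Fin.last (p + 1)) (frontFace (p + 1) q x) = frontFace p (q + 1) x :=
    (frontFace_δ_of_eq h (j := ⟨p + 1, by omega⟩) rfl x).symm.trans
      (frontFace_δ_of_lt h (Nat.lt_succ_self p) x)
  have back_zero : Y.δ 0 (backFace p (q + 1) y) = backFace (p + 1) q y :=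
    (backFace_δ_of_eq h (j := ⟨p, by omega⟩) rfl y).symm.trans (backFace_δ_of_le h le_rfl y)
  have front (i : Fin (p + 1)) :
      T (frontFace p q (X.δ ⟨i, by omega⟩ x)) (backFace p q (Y.δ ⟨i, by omega⟩ y)) =
        T (X.δ i.castSucc (frontFace (p + 1) q x)) (backFace (p + 1) q y) := by
    rw [frontFace_δ_of_eq h (i := i.castSucc) rfl, backFace_δ_of_le h (Nat.le_of_lt_succ i.2)]
  have back (i : Fin (q + 1)) :
      T (frontFace p q (X.δ ⟨p + 1 + i, by omega⟩ x)) (backFace p q (Y.δ ⟨p + 1 + i, by omega⟩ y)) =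
        T (frontFace p (q + 1) x) (Y.δ i.succ (backFace p (q + 1) y)) := by
    rw [frontFace_δ_of_lt h (show p < p + 1 + i by omega),
      backFace_δ_of_eq h (i := i.succ) (show p + 1 + i = p + (i + 1) by omega)]
  have sign (i : ℕ) : (-1 : ℤ) ^ (p + 1 + i) = (-1) ^ p * (-1) ^ (i + 1) := by ring
  rw [sum_fin_eq_sum_add_sum (show (p + 1) + (q + 1) = n + 2 by omega),
    Fin.sum_univ_castSucc (n := p + 1), Fin.sum_univ_succ (n := q + 1), front_last, back_zero]
  simp only [front, back, smul_add, Finset.smul_sum, smul_smul, Fin.val_castSucc, Fin.val_last,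
    Fin.val_zero, Fin.val_succ, sign, pow_zero, mul_one, pow_succ _ p, mul_neg_one, neg_smul]
  abel

lemma map_mem_degenerate {f : ⦋n⦌ ⟶ ⦋m⦌} {i : Fin n} (h : f i.castSucc = f i.succ)
    (x : X _⦋m⦌) : X.map f.op x ∈ X.degenerate n := by
  obtain _ | n := n
  · exact i.elim0
  · obtain ⟨f', rfl⟩ := SimplexCategory.eq_σ_comp_of_not_injective' f i h
    rw [← map_op_map_op]
    exact X.σ_mem_degenerate i _

lemma map_subinterval_mem_degenerate {a l : ℕ} (hal : a + l ≤ n) {f : ⦋n⦌ ⟶ ⦋m⦌} {i : Fin n}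
    (h : f i.castSucc = f i.succ) (hi : a ≤ i) (hi' : i < a + l) (x : X _⦋m⦌) :
    X.map (SimplexCategory.subinterval a l hal).op (X.map f.op x) ∈ X.degenerate l := by
  rw [map_op_map_op]
  have hlt : (i : ℕ) - a < l := by omega
  have hcast : SimplexCategory.subinterval a l hal (Fin.castSucc ⟨i - a, hlt⟩) = i.castSucc :=
    Fin.ext (Nat.sub_add_cancel hi)
  have hsucc : SimplexCategory.subinterval a l hal (Fin.succ ⟨i - a, hlt⟩) = i.succ :=
    Fin.ext (show i - a + 1 + a = (i : ℕ) + 1 by omega)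
  exact map_mem_degenerate (i := ⟨i - a, hlt⟩)
    ((congrArg f hcast).trans (h.trans (congrArg f hsucc).symm)) x

end

/-- The tensor product of the normalized chain complexes of two simplicial sets. -/
noncomputable abbrev normalizedTensor (k : Type) [CommRing k] (X Y : SSet.{u}) :
    ChainComplex (ModuleCat.{u} k) ℕ :=
  tensorComplex (X.normalizedChainComplex (SSet.coeff.{u} k))
    (Y.normalizedChainComplex (SSet.coeff.{u} k))

section

variable {X Y : SSet.{u}} (k : Type) [CommRing k] {p q m m' n : ℕ}

/-- The component of bidegree `(p, q)` of the Alexander-Whitney map on the simplex `(x, y)`. It is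
null by convention if `p + q ≠ n`. -/
noncomputable def awTerm (x : X _⦋n⦌) (y : Y _⦋n⦌) (p q : ℕ) : (normalizedTensor k X Y).X n :=
  if h : p + q = n then
    tmulDeg h (X.normGen k (frontFace p q x)) (Y.normGen k (backFace p q y)) else 0

/-- The Alexander-Whitney map on the simplex `(x, y)`. -/
noncomputable def awSum (x : X _⦋n⦌) (y : Y _⦋n⦌) : (normalizedTensor k X Y).X n :=
  ∑ pq ∈ Finset.HasAntidiagonal.antidiagonal n, awTerm k x y pq.1 pq.2

open HomologicalComplex.mapBifunctor in
lemma D₁_awTerm_add_D₂_awTerm (h : p + q = n) (x : X _⦋n + 1⦌) (y : Y _⦋n + 1⦌) :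
    (D₁ _ _ (tensorBifunctor k) (ComplexShape.down ℕ) (n + 1) n).hom (awTerm k x y (p + 1) q) +
      (D₂ _ _ (tensorBifunctor k) (ComplexShape.down ℕ) (n + 1) n).hom (awTerm k x y p (q + 1)) =
      ∑ j : Fin (n + 2), (-1 : ℤ) ^ (j : ℕ) • awTerm k (X.δ j x) (Y.δ j y) p q := by
  simp only [awTerm, dif_pos h]
  rw [dif_pos (by omega : p + 1 + q = n + 1), dif_pos (by omega : p + (q + 1) = n + 1),
    D₁_tmulDeg_succ _ h, D₂_tmulDeg_succ _ h, d_normGen, d_normGen,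
    sum_frontFace_backFace_δ h fun a b => tmulDeg h (X.normGen k a) (Y.normGen k b)]
  simp only [map_sum, map_zsmul, LinearMap.sum_apply, LinearMap.smul_apply]

open HomologicalComplex.mapBifunctor in
lemma d_awSum (x : X _⦋n + 1⦌) (y : Y _⦋n + 1⦌) :
    ((normalizedTensor k X Y).d (n + 1) n).hom (awSum k x y) =
      ∑ j : Fin (n + 2), (-1 : ℤ) ^ (j : ℕ) • awSum k (X.δ j x) (Y.δ j y) := by
  have D₁_zero : (D₁ _ _ (tensorBifunctor k) (ComplexShape.down ℕ) (n + 1) n).hom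
      (awTerm k x y 0 (n + 1)) = 0 := by
    rw [awTerm, dif_pos (by omega), D₁_tmulDeg_zero]
  have D₂_zero : (D₂ _ _ (tensorBifunctor k) (ComplexShape.down ℕ) (n + 1) n).hom
      (awTerm k x y (n + 1) 0) = 0 := by
    rw [awTerm, dif_pos (by omega), D₂_tmulDeg_zero]
  rw [d_eq, ModuleCat.hom_add, LinearMap.add_apply]
  simp only [awSum, map_sum, Finset.smul_sum]
  rw [Finset.Nat.sum_antidiagonal_succ, Finset.Nat.sum_antidiagonal_succ', Finset.sum_comm,
    D₁_zero, D₂_zero, zero_add, zero_add, ← Finset.sum_add_distrib]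
  exact Finset.sum_congr rfl fun pq hpq =>
    D₁_awTerm_add_D₂_awTerm k (Finset.HasAntidiagonal.mem_antidiagonal.1 hpq) x y

lemma awTerm_map_left_eq_zero {f : ⦋n⦌ ⟶ ⦋m⦌} {i : Fin n} (h : f i.castSucc = f i.succ)
    (hi : i < p) (x : X _⦋m⦌) (y : Y _⦋n⦌) : awTerm k (X.map f.op x) y p q = 0 := by
  rw [awTerm]
  split_ifs with hn
  · rw [frontFace, normGen_eq_zero k
      (map_subinterval_mem_degenerate _ h (Nat.zero_le _) (by omega) x), map_zero,
      LinearMap.zero_apply]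
  · rfl

lemma awTerm_map_right_eq_zero {g : ⦋n⦌ ⟶ ⦋m⦌} {i : Fin n} (h : g i.castSucc = g i.succ)
    (hi : p ≤ i) (x : X _⦋n⦌) (y : Y _⦋m⦌) : awTerm k x (Y.map g.op y) p q = 0 := by
  rw [awTerm]
  split_ifs with hn
  · rw [backFace, normGen_eq_zero k (map_subinterval_mem_degenerate _ h hi (by omega) y), map_zero]
  · rfl

lemma awSum_map_map_eq_zero {f : ⦋n⦌ ⟶ ⦋m⦌} {g : ⦋n⦌ ⟶ ⦋m'⦌} {i j : Fin n}
    (hf : f i.castSucc = f i.succ) (hg : g j.castSucc = g j.succ) (hij : i ≤ j) (x : X _⦋m⦌)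
    (y : Y _⦋m'⦌) : awSum k (X.map f.op x) (Y.map g.op y) = 0 := by
  refine Finset.sum_eq_zero fun pq _ => ?_
  rcases Nat.lt_or_ge i pq.1 with h | h
  · exact awTerm_map_left_eq_zero k hf h x _
  · exact awTerm_map_right_eq_zero k hg (h.trans hij) _ y

lemma awSum_eq_zero_of_mem_degenerate {ρ : (X ⊗ Y : SSet.{u}) _⦋n⦌}
    (h : ρ ∈ (X ⊗ Y : SSet.{u}).degenerate n) : awSum k ρ.1 ρ.2 = 0 := by
  obtain _ | n := n
  · rw [SSet.degenerate_zero] at h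
    exact h.elim
  · rw [SSet.degenerate_eq_iUnion_range_σ, Set.mem_iUnion] at h
    obtain ⟨i, ρ, rfl⟩ := h
    have σ_castSucc : SimplexCategory.σ i i.castSucc = SimplexCategory.σ i i.succ :=
      (i.predAbove_castSucc_self).trans i.predAbove_succ_self.symm
    exact awSum_map_map_eq_zero k σ_castSucc σ_castSucc le_rfl ρ.1 ρ.2

lemma awSum_simplex_of_isTarget {π : SPath p q n} (h : π.IsTarget) (x : X _⦋p⦌) (y : Y _⦋q⦌) :
    awSum k (π.simplex x y).1 (π.simplex x y).2 = 0 := by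
  obtain ⟨l, ⟨i, j, hi, hj, vertical, horizontal⟩, -⟩ := h
  refine awSum_map_map_eq_zero k (f := π.fst) (g := π.snd) (i := i) (j := j) vertical horizontal ?_
    x y
  rw [← hj, Fin.ext_iff, Fin.val_succ, Fin.val_castSucc] at hi
  exact Fin.le_def.2 (by omega)

lemma frontFace_simplex_last (x : X _⦋p⦌) (y : Y _⦋q⦌) :
    frontFace p q ((SPath.last p q).simplex x y).1 = x := by
  refine (map_op_map_op x).trans ?_
  have : SimplexCategory.subinterval 0 p (by omega) ≫ (SPath.last p q).fst = 𝟙 _ := by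
    ext i : 3
    exact Fin.ext (min_eq_left i.is_le)
  rw [this, op_id, CategoryTheory.Functor.map_id]
  rfl

lemma backFace_simplex_last (x : X _⦋p⦌) (y : Y _⦋q⦌) :
    backFace p q ((SPath.last p q).simplex x y).2 = y := by
  refine (map_op_map_op y).trans ?_
  have : SimplexCategory.subinterval p q le_rfl ≫ (SPath.last p q).snd = 𝟙 _ := by
    ext i : 3
    exact Fin.ext (Nat.add_sub_cancel i p)
  rw [this, op_id, CategoryTheory.Functor.map_id]
  rfl

lemma awSum_simplex_last (x : X _⦋p⦌) (y : Y _⦋q⦌) :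
    awSum k ((SPath.last p q).simplex x y).1 ((SPath.last p q).simplex x y).2 =
      tmulDeg rfl (X.normGen k x) (Y.normGen k y) := by
  refine (Finset.sum_eq_single (p, q) ?_ ?_).trans ?_
  · rintro ⟨p', q'⟩ h hne
    have h : p' + q' = p + q := Finset.HasAntidiagonal.mem_antidiagonal.1 h
    have hp : p' ≠ p := by
      rintro rfl
      exact hne (by rw [Nat.add_left_cancel h])
    rcases lt_or_gt_of_ne hp with hp | hp
    · refine awTerm_map_right_eq_zero k (i := ⟨p', by omega⟩) (Fin.ext ?_) le_rfl _ _
      exact show p' - p = p' + 1 - p by omega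
    · refine awTerm_map_left_eq_zero k (i := ⟨p, by omega⟩) (Fin.ext ?_) hp _ _
      exact show min p p = min (p + 1) p by omega
  · exact fun h => (h (Finset.HasAntidiagonal.mem_antidiagonal.2 (by rfl))).elim
  · rw [awTerm, dif_pos rfl, frontFace_simplex_last, backFace_simplex_last]

end

section

variable (k : Type) [CommRing k] (X Y : SSet.{u})

/-- The Alexander-Whitney map, in degree `n`. -/
noncomputable def awLin (n : ℕ) :
    ((X ⊗ Y : SSet.{u}).normalizedChainComplex (SSet.coeff.{u} k)).X n →ₗ[k]
      (normalizedTensor k X Y).X n :=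
  ((X ⊗ Y : SSet.{u}).normBasis k n).constr k fun ρ => awSum k ρ.1.1 ρ.1.2

lemma awLin_normGen {n : ℕ} (ρ : (X ⊗ Y : SSet.{u}) _⦋n⦌) :
    awLin k X Y n ((X ⊗ Y : SSet.{u}).normGen k ρ) = awSum k ρ.1 ρ.2 := by
  by_cases h : ρ ∈ (X ⊗ Y : SSet.{u}).nonDegenerate n
  · rw [← SSet.normBasis_apply k _ ⟨ρ, h⟩, awLin, Module.Basis.constr_basis]
  · have h := (SSet.mem_degenerate_iff_notMem_nonDegenerate _ ρ).2 h
    rw [normGen_eq_zero k h, map_zero, awSum_eq_zero_of_mem_degenerate k h]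

/-- The Alexander-Whitney map. -/
noncomputable def awMap :
    (X ⊗ Y : SSet.{u}).normalizedChainComplex (SSet.coeff.{u} k) ⟶ normalizedTensor k X Y where
  f n := ModuleCat.ofHom (awLin k X Y n)
  comm' := by
    rintro _ n rfl
    refine ModuleCat.hom_ext (((X ⊗ Y : SSet.{u}).normBasis k (n + 1)).ext fun ρ => ?_)
    rw [SSet.normBasis_apply]
    change ((normalizedTensor k X Y).d (n + 1) n).hom (awLin k X Y (n + 1) _) =
      awLin k X Y n
        ((((X ⊗ Y : SSet.{u}).normalizedChainComplex (SSet.coeff.{u} k)).d (n + 1) n).hom _)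
    rw [awLin_normGen, d_awSum, d_normGen, map_sum]
    refine Finset.sum_congr rfl fun j _ => ?_
    rw [map_zsmul, awLin_normGen]
    rfl

end

/-! ### The critical complex -/

section

open AlgCellComplex SPathCode

variable (k : Type) [CommRing k] (X Y : SSet.{u})

variable {X Y} in
/-- The critical simplex `λ_{p,q}(σ, τ)`. -/
def criticalCode {p q n : ℕ} (h : p + q = n) (σ : X.nonDegenerate p) (τ : Y.nonDegenerate q) :
    SPathCode X Y n :=
  ⟨p, q, σ, τ, h ▸ SPath.last p q, by subst h; exact SPath.interior_last p q⟩

variable {X Y} in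
lemma isCritical_iff_exists_eq_criticalCode {n : ℕ} {c : SPathCode X Y n} :
    c.π.IsCritical ↔ ∃ h : c.p + c.q = n, c = criticalCode h c.σ c.τ := by
  obtain ⟨p, q, σ, τ, π, hπ⟩ := c
  dsimp only
  constructor
  · intro h
    obtain rfl := h.eq_add hπ
    obtain rfl := h.eq_last hπ
    exact ⟨rfl, rfl⟩
  · rintro ⟨rfl, h⟩
    injection h with _ _ _ _ h
    rw [h]
    exact SPath.isCritical_last p q

/-- The bijection between the generators of the tensor product of the normalized chain complexes and
the critical cells of the Eilenberg-Zilber vector field. -/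
noncomputable def criticalsEquiv (n : ℕ) :
    (Σ pq : {pq : ℕ × ℕ // pq.1 + pq.2 = n}, X.nonDegenerate pq.1.1 × Y.nonDegenerate pq.1.2) ≃
      criticals (ezVectorFieldOver k X Y) n :=
  .ofBijective
    (fun e => ⟨equivNonDegenerate X Y n (criticalCode e.1.2 e.2.1 e.2.2),
      mem_criticals_ezVectorFieldOver.2
        (isCritical_iff_exists_eq_criticalCode.2 ⟨e.1.2, rfl⟩)⟩) <| by
    constructor
    · rintro ⟨⟨⟨p, q⟩, h⟩, σ, τ⟩ ⟨⟨⟨p', q'⟩, h'⟩, σ', τ'⟩ e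
      have e := (equivNonDegenerate X Y n).injective (congrArg Subtype.val e)
      obtain rfl : p = p' := congrArg SPathCode.p e
      obtain rfl : q = q' := congrArg SPathCode.q e
      injection e with _ _ hσ hτ
      obtain rfl : σ = σ' := hσ
      obtain rfl : τ = τ' := hτ
      rfl
    · rintro ⟨ρ, hρ⟩
      obtain ⟨c, rfl⟩ := (equivNonDegenerate X Y n).surjective ρ
      obtain ⟨h, hc⟩ :=
        isCritical_iff_exists_eq_criticalCode.1 (mem_criticals_ezVectorFieldOver.1 hρ)
      exact ⟨⟨⟨(c.p, c.q), h⟩, c.σ, c.τ⟩, Subtype.ext (congrArg (equivNonDegenerate X Y n) hc.symm)⟩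

/-- The identification of the critical complex of the Eilenberg-Zilber vector field with the tensor
product of the normalized chain complexes. -/
noncomputable def criticalIdentification :
    CriticalIdentification (ezVectorFieldOver k X Y) (normalizedTensor k X Y) := fun n =>
  ((tensorBasis (X.normBasis k) (Y.normBasis k) n).reindex (criticalsEquiv k X Y n)).repr.symm

lemma criticalIdentification_single_criticalsEquiv {p q : ℕ} (σ : X.nonDegenerate p)
    (τ : Y.nonDegenerate q) :
    criticalIdentification k X Y (p + q)
        (Finsupp.single (criticalsEquiv k X Y (p + q) ⟨⟨(p, q), rfl⟩, σ, τ⟩) 1) =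
      tmulDeg rfl (X.normBasis k p σ) (Y.normBasis k q τ) := by
  rw [criticalIdentification, Module.Basis.repr_symm_single_one, Module.Basis.reindex_apply,
    Equiv.symm_apply_apply, tensorBasis_apply]

lemma awMap_basis_of_mem_targets {n : ℕ} {ρ : (X ⊗ Y : SSet.{u}).nonDegenerate n}
    (h : ρ ∈ targets (ezVectorFieldOver k X Y) n) :
    ((awMap k X Y).f n).hom ((X ⊗ Y : SSet.{u}).normBasis k n ρ) = 0 := by
  obtain ⟨c, rfl⟩ := (equivNonDegenerate X Y n).surjective ρ
  rw [SSet.normBasis_apply]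
  exact (awLin_normGen k X Y _).trans
    (awSum_simplex_of_isTarget k (mem_targets_ezVectorFieldOver.1 h) _ _)

lemma awMap_basis_criticals {n : ℕ} (c : criticals (ezVectorFieldOver k X Y) n) :
    ((awMap k X Y).f n).hom ((X ⊗ Y : SSet.{u}).normBasis k n c.1) =
      criticalIdentification k X Y n (Finsupp.single c 1) := by
  obtain ⟨⟨⟨⟨p, q⟩, rfl⟩, σ, τ⟩, rfl⟩ := (criticalsEquiv k X Y n).surjective c
  rw [criticalIdentification_single_criticalsEquiv, SSet.normBasis_apply, SSet.normBasis_apply]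
  refine (congrArg (awLin k X Y (p + q)) (SSet.normBasis_apply k (X ⊗ Y) _)).trans ?_
  exact (awLin_normGen k X Y _).trans (awSum_simplex_last k σ.1 τ.1)

end

theorem theorem46504_general (k : Type) [CommRing k] (X Y : SSet.{u}) :
    AlgCellComplex.IsDiscreteVectorField (ezVectorFieldOver k X Y) ∧
    AlgCellComplex.IsAdmissible (ezVectorFieldOver k X Y) ∧
    (∀ (n : ℕ) (ρ : (X ⊗ Y : SSet.{u}).nonDegenerate n),
      (ρ ∈ AlgCellComplex.sources (ezVectorFieldOver k X Y) n ↔ HasSPath ρ.1 SPath.IsSource) ∧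
      (ρ ∈ AlgCellComplex.targets (ezVectorFieldOver k X Y) n ↔ HasSPath ρ.1 SPath.IsTarget) ∧
      (ρ ∈ AlgCellComplex.criticals (ezVectorFieldOver k X Y) n ↔
        HasSPath ρ.1 SPath.IsCritical)) ∧
    ∃ (φ : CriticalIdentification (ezVectorFieldOver k X Y)
          (tensorComplex (X.normalizedACC k).complex (Y.normalizedACC k).complex))
      (EZ : Reduction (SSet.normalizedACC k (X ⊗ Y)).complex
          (tensorComplex (X.normalizedACC k).complex (Y.normalizedACC k).complex)),
      (∀ (p q : ℕ) (σ : X.nonDegenerate p) (τ : Y.nonDegenerate q),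
        ∃ c : AlgCellComplex.criticals (ezVectorFieldOver k X Y) (p + q),
          Subtype.val (p := (· ∈ (X ⊗ Y : SSet.{u}).nonDegenerate (p + q))) c.1 =
              (SPath.last p q).simplex σ.1 τ.1 ∧
            φ (p + q) (Finsupp.single c 1) =
              tmulComplex (X.normalizedACC k).complex (Y.normalizedACC k).complex
                ((X.normalizedACC k).basis p σ) ((Y.normalizedACC k).basis q τ)) ∧
      IsWReduction (SSet.normalizedACC k (X ⊗ Y)) (ezVectorFieldOver k X Y) φ EZ := by
  have isDiscrete := isDiscreteVectorField_ezVectorFieldOver k X Y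
  have isAdmissible := (isRank_ezVectorFieldOver k X Y).isAdmissible
  refine ⟨isDiscrete, isAdmissible, fun n ρ => ?_, criticalIdentification k X Y, ?_⟩
  · obtain ⟨c, rfl⟩ := (SPathCode.equivNonDegenerate X Y n).surjective ρ
    exact ⟨mem_sources_ezVectorFieldOver.trans (c.hasSPath_iff SPath.IsSource).symm,
      mem_targets_ezVectorFieldOver.trans (c.hasSPath_iff SPath.IsTarget).symm,
      mem_criticals_ezVectorFieldOver.trans (c.hasSPath_iff SPath.IsCritical).symm⟩
  · obtain ⟨EZ, hEZ⟩ := isDiscrete.exists_isWReduction isAdmissible (criticalIdentification k X Y)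
      (awMap k X Y) (fun _ _ => awMap_basis_of_mem_targets k X Y)
      (fun _ => awMap_basis_criticals k X Y)
    exact ⟨EZ, fun p q σ τ => ⟨criticalsEquiv k X Y (p + q) ⟨⟨(p, q), rfl⟩, σ, τ⟩, rfl,
      criticalIdentification_single_criticalsEquiv k X Y σ τ⟩, hEZ⟩

theorem theorem46504 (X Y : SSet.{u}) :
    -- the Eilenberg-Zilber vector field is an admissible discrete vector field
    AlgCellComplex.IsDiscreteVectorField (ezVectorField X Y) ∧
    AlgCellComplex.IsAdmissible (ezVectorField X Y) ∧
    -- its source, target and critical cells are those described by the s-paths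
    (∀ (n : ℕ) (ρ : (X ⊗ Y : SSet.{u}).nonDegenerate n),
      (ρ ∈ AlgCellComplex.sources (ezVectorField X Y) n ↔ HasSPath ρ.1 SPath.IsSource) ∧
      (ρ ∈ AlgCellComplex.targets (ezVectorField X Y) n ↔ HasSPath ρ.1 SPath.IsTarget) ∧
      (ρ ∈ AlgCellComplex.criticals (ezVectorField X Y) n ↔ HasSPath ρ.1 SPath.IsCritical)) ∧
    -- it induces a W-reduction on the tensor product, where the critical cells correspond to the
    -- generators of the tensor product
    ∃ (φ : CriticalIdentification (ezVectorField X Y)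
          (tensorComplex (X.normalizedACC ℤ).complex (Y.normalizedACC ℤ).complex))
      (EZ : Reduction (SSet.normalizedACC ℤ (X ⊗ Y)).complex
          (tensorComplex (X.normalizedACC ℤ).complex (Y.normalizedACC ℤ).complex)),
      (∀ (p q : ℕ) (σ : X.nonDegenerate p) (τ : Y.nonDegenerate q),
        ∃ c : AlgCellComplex.criticals (ezVectorField X Y) (p + q),
          Subtype.val (p := (· ∈ (X ⊗ Y : SSet.{u}).nonDegenerate (p + q))) c.1 =
              (SPath.last p q).simplex σ.1 τ.1 ∧
            φ (p + q) (Finsupp.single c 1) =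
              tmulComplex (X.normalizedACC ℤ).complex (Y.normalizedACC ℤ).complex
                ((X.normalizedACC ℤ).basis p σ) ((Y.normalizedACC ℤ).basis q τ)) ∧
      IsWReduction (SSet.normalizedACC ℤ (X ⊗ Y)) (ezVectorField X Y) φ EZ :=
  theorem46504_general ℤ X Y
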